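/- Let $v\ge 0$ be an integer. A vector space partition of $\operatorname{PG}(v-1,2)$ is a set $\mathcal P$ of non-zero subspaces of $\mathbb F_2^v$ such that every point (one-dimensional subspace of $\mathbb F_2^v$) is contained in exactly one element of $\mathcal P$; dimensions are vector space dimensions. For integers $a_1>a_2>\dots>a_s\ge 1$ and $m_1,\dots,m_s\ge 0$ we say that $\mathcal P$ has a supertail of type $a_1^{m_1}a_2^{m_2}\cdots a_s^{m_s}$ if $\mathcal P$ contains exactly $m_j$ elements of dimension $a_j$ for each $1\le j\le s$, contains at least one element of dimension greater than $a_1$, and every element of $\mathcal P$ of dimension at most $a_1$ has dimension $a_j$ for some $1\le j\le s$. Then no vector space partition $\mathcal P$ of $\operatorname{PG}(v-1,2)$ has a supertail of one of the types $$3^4 2^4 1^5,\quad 3^4 2^3 1^8,\quad 3^4 2^2 1^{11},\quad 3^4 2^1 1^{14},\quad 3^4 2^0 1^{17},\quad 3^1 2^{11} 1^5 .$$ -/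

import Mathlib

/-- A vector space partition of the projective space `PG(V)` of a `K`-vector space `V`: a set `P` of
(non-zero) subspaces of `V` such that every point of the projective space is contained in exactly
one member of `P`. Dimensions are vector space dimensions: points have dimension `1`,
lines dimension `2`, planes dimension `3`, and so on. -/
def IsVectorSpacePartition (K : Type*) {V : Type*} [Field K] [AddCommGroup V] [Module K V]
    (P : Set (Submodule K V)) : Prop :=
  (∀ B ∈ P, B ≠ ⊥) ∧ ∀ p : Projectivization K V, ∃! B : Submodule K V, B ∈ P ∧ p.submodule ≤ B

/-- `P` has a supertail of type `(a 0)^(m 0) (a 1)^(m 1) ... (a n)^(m n)`, where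
`a 0 > a 1 > ... > a n ≥ 1`: exactly `m j` members of `P` have dimension `a j`, some member of `P`
has dimension greater than `a 0`, and every member of dimension at most `a 0` has its
dimension among the `a j`. Multiplicities `m j = 0` are allowed. -/
def HasSupertail (K : Type*) {V : Type*} [Field K] [AddCommGroup V] [Module K V]
    (P : Set (Submodule K V)) {n : ℕ} (a m : Fin (n + 1) → ℕ) : Prop :=
  StrictAnti a ∧ (∀ j, 1 ≤ a j) ∧
  (∀ j, {B : Submodule K V | B ∈ P ∧ Module.finrank K B = a j}.encard = (m j : ℕ∞)) ∧
  (∃ A ∈ P, a 0 < Module.finrank K A) ∧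
  (∀ B ∈ P, Module.finrank K B ≤ a 0 → ∃ j, Module.finrank K B = a j)

/-!
Let `T` be the set of points that lie in members of dimension at most three. Every other member,
and the whole space, has a number of vectors divisible by `16`, so every hyperplane misses a
multiple of eight points of `T`: the set is `8`-divisible (`isEightDivisible_biUnion_pts`). In each
of the six types it has `45` points. Nearly everything is read off from first and second moments of
the character sums `W T u = ∑ x ∈ T, (-1) ^ u x` over all functionals `u`, possibly weighted by a
few characters. These moments count solutions of linear equations in `T`, while divisibility forces
`W T` into the residue class of `45` modulo `16`.

*Four planes.* Give the points of the four planes weight `1` and the others weight `-1`. The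
character sums of this signed set are congruent to `11` modulo `16`, so they avoid the interval
between `-5` and `11`. This contradicts their mean `0` and mean square `45 < 55`
(`IsEightDivisible.false_of_four_planes`).

*One plane and eleven lines.* Containing a plane `E` forces `T` to be the union of three disjoint
solids. It is enough to find an affine solid `S` in `T`, namely a translate of a three-dimensional
subspace, and a functional `c` that is `1` on `S` and misses fewer than `24` points of `T`: then
the solid spanned by `S` lies in `T` (`IsEightDivisible.exists_solid`), and the remaining `30`
points split into two further solids by similar moment computations
(`IsEightDivisible.exists_three_solids`). If some hyperplane misses just eight points, these form
`S`. Otherwise every hyperplane that does not contain `T` misses `16` or `24` points. Take one that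
does not contain `E` and misses a set `D` of `16` points. The other functionals cut out of `D` a
self-orthogonal code in which every point `e` of `D ∩ E` lies in at least seven words of weight
four. Either three of these words yield `S`, or nearly all of them contain a second common point `a
∈ E`; in that case the point `e + a` lies on more than eight lines inside `T`, which a second
moment forbids (`IsEightDivisible.exists_solid_of_plane_aux`).

Finally the plane lies in one of the three solids. Every line of the supertail lies in one of the
other two solids or meets all three in one point each, and counting the points of the second and
the third solid off a suitable hyperplane leaves room for at most ten lines
(`IsEightDivisible.card_lines_le`).
-/

namespace BinarySpace

open Finset

/-! ### Characters of a binary space and their moments -/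

section Characters

variable {V : Type*} [AddCommGroup V] [Module (ZMod 2) V]

/-- The character `(-1) ^ u x` of the binary space `V`, with integer values. -/
def χ (x : V) (u : Module.Dual (ZMod 2) V) : ℤ := if u x = 0 then 1 else -1

/-- The character sum of a finite set `A` of vectors; it equals `#A - 2 * #{x ∈ A | u x = 1}`. -/
def W (A : Finset V) (u : Module.Dual (ZMod 2) V) : ℤ := ∑ x ∈ A, χ x u

lemma eq_one_of_ne_zero {a : ZMod 2} (h : a ≠ 0) : a = 1 := by
  revert h; revert a; decide

lemma χ_of_eq_zero {x : V} {u : Module.Dual (ZMod 2) V} (h : u x = 0) : χ x u = 1 := if_pos h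

lemma χ_of_ne_zero {x : V} {u : Module.Dual (ZMod 2) V} (h : u x ≠ 0) : χ x u = -1 := if_neg h

lemma χ_eq_or (x : V) (u : Module.Dual (ZMod 2) V) : χ x u = 1 ∨ χ x u = -1 := by
  unfold χ; split_ifs <;> simp

lemma sign_mul_sign : ∀ a b : ZMod 2, (if a + b = 0 then (1 : ℤ) else -1) =
    (if a = 0 then 1 else -1) * (if b = 0 then 1 else -1) := by decide

lemma χ_add (x y : V) (u : Module.Dual (ZMod 2) V) : χ (x + y) u = χ x u * χ y u := by
  unfold χ; rw [map_add]; exact sign_mul_sign _ _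

lemma χ_add_dual (x : V) (u w : Module.Dual (ZMod 2) V) : χ x (u + w) = χ x u * χ x w := by
  unfold χ; rw [LinearMap.add_apply]; exact sign_mul_sign _ _

@[simp] lemma χ_zero (u : Module.Dual (ZMod 2) V) : χ (0 : V) u = 1 := by simp [χ]

lemma W_zero (A : Finset V) : W A 0 = #A := by simp [W, χ]

lemma exists_dual_ne_zero {x : V} (hx : x ≠ 0) : ∃ u : Module.Dual (ZMod 2) V, u x ≠ 0 := by
  by_contra! h
  exact hx ((Module.forall_dual_apply_eq_zero_iff (ZMod 2) x).1 h)

lemma add_eq_zero_iff {x y : V} : x + y = 0 ↔ x = y := by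
  rw [← ZModModule.sub_eq_add, sub_eq_zero]

lemma add_add_self (x y : V) : x + y + y = x := by
  rw [add_assoc, ZModModule.add_self, add_zero]

lemma add_add_self_left (x y : V) : x + (x + y) = y := by
  rw [← add_assoc, ZModModule.add_self, zero_add]

lemma W_add_W_add (A : Finset V) (u c : Module.Dual (ZMod 2) V) :
    W A u + W A (u + c) = 2 * W {x ∈ A | c x = 0} u := by
  simp only [W, χ_add_dual, sum_filter, mul_sum, ← sum_add_distrib]
  refine sum_congr rfl fun x _ => ?_
  by_cases h : c x = 0
  · simp [h, χ_of_eq_zero h]; ring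
  · simp [h, χ_of_ne_zero h]

lemma W_sub_W_add (A : Finset V) (u c : Module.Dual (ZMod 2) V) :
    W A u - W A (u + c) = 2 * W {x ∈ A | c x ≠ 0} u := by
  simp only [W, χ_add_dual, sum_filter, mul_sum, ← sum_sub_distrib]
  refine sum_congr rfl fun x _ => ?_
  by_cases h : c x = 0
  · simp [h, χ_of_eq_zero h]
  · simp [h, χ_of_ne_zero h]; ring

lemma W_eq_card_sub (A : Finset V) (u : Module.Dual (ZMod 2) V) :
    W A u = #A - 2 * #{x ∈ A | u x ≠ 0} := by
  have := W_sub_W_add A 0 u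
  rw [W_zero, W_zero, zero_add] at this
  linarith

lemma W_sdiff [DecidableEq V] {A B : Finset V} (h : B ⊆ A) (u : Module.Dual (ZMod 2) V) :
    W (A \ B) u = W A u - W B u := by
  have := sum_sdiff (f := fun x => χ x u) h
  simp only [W]; linarith


/-- If `m ∣ a` then `a / m` and `a / m + 1` are consecutive integers, so their product is not
negative. -/
lemma mul_add_nonneg_of_dvd {m a : ℤ} (h : m ∣ a) : 0 ≤ a * (a + m) := by
  obtain ⟨k, rfl⟩ := h
  have hk : 0 ≤ k * (k + 1) := by
    rcases le_or_gt 0 k with hk | hk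
    · positivity
    · nlinarith
  have : m * k * (m * k + m) = m ^ 2 * (k * (k + 1)) := by ring
  rw [this]; positivity


variable [Fintype V]

noncomputable instance : Fintype (Module.Dual (ZMod 2) V) := 
  @Fintype.ofFinite _ (Finite.of_injective (fun u => (u : V → ZMod 2)) DFunLike.coe_injective)

/-- Orthogonality of characters. -/
lemma sum_χ [DecidableEq V] (x : V) :
    ∑ u : Module.Dual (ZMod 2) V, χ x u =
      if x = 0 then (Fintype.card (Module.Dual (ZMod 2) V) : ℤ) else 0 := by
  split_ifs with hx
  · simp [hx]
  · obtain ⟨w, hw⟩ := exists_dual_ne_zero hx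
    have h := Fintype.sum_equiv (Equiv.addRight w) (fun u => χ x (u + w)) (fun u => χ x u)
      (fun u => rfl)
    simp only [χ_add_dual, χ_of_ne_zero hw, ← sum_mul] at h
    linarith

/-- First moment of a character sum. -/
lemma sum_χ_mul_W [DecidableEq V] (y : V) (A : Finset V) :
    ∑ u : Module.Dual (ZMod 2) V, χ y u * W A u =
      (Fintype.card (Module.Dual (ZMod 2) V) : ℤ) * (if y ∈ A then 1 else 0) := by
  simp only [W, mul_sum, ← χ_add]
  rw [sum_comm]
  simp only [sum_χ, add_eq_zero_iff]
  simp

/-- Mixed second moment of two character sums. -/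
lemma sum_χ_mul_W_mul_W [DecidableEq V] (y : V) (A B : Finset V) :
    ∑ u : Module.Dual (ZMod 2) V, χ y u * (W A u * W B u) =
      (Fintype.card (Module.Dual (ZMod 2) V) : ℤ) * #{x ∈ A | x + y ∈ B} := by
  have h : ∀ u : Module.Dual (ZMod 2) V, χ y u * (W A u * W B u) =
      ∑ x ∈ A, χ (x + y) u * W B u := by
    intro u
    simp only [χ_add, W, sum_mul, mul_sum]
    rw [sum_comm]
    refine sum_congr rfl fun x _ => sum_congr rfl fun z _ => by ring
  simp only [h]
  rw [sum_comm]
  simp only [sum_χ_mul_W, ← mul_sum]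
  simp

lemma sum_W [DecidableEq V] (A : Finset V) (h0 : (0 : V) ∉ A) :
    ∑ u : Module.Dual (ZMod 2) V, W A u = 0 := by
  have := sum_χ_mul_W (0 : V) A
  simpa [h0] using this

lemma sum_W_mul_W [DecidableEq V] (A B : Finset V) :
    ∑ u : Module.Dual (ZMod 2) V, W A u * W B u =
      (Fintype.card (Module.Dual (ZMod 2) V) : ℤ) * #(A ∩ B) := by
  have := sum_χ_mul_W_mul_W (0 : V) A B
  simpa [filter_mem_eq_inter] using this

lemma card_dual_pos : (0 : ℤ) < Fintype.card (Module.Dual (ZMod 2) V) := by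
  exact_mod_cast Fintype.card_pos

end Characters

/-! ### Points of a subspace -/

section Points

variable {V : Type*} [AddCommGroup V] [Module (ZMod 2) V] [Fintype V]

open Classical in
/-- The points of the subspace `B`, that is, its non-zero vectors (over the field with two elements
a one-dimensional subspace has exactly one non-zero vector). -/
noncomputable def pts (B : Submodule (ZMod 2) V) : Finset V := {x | x ∈ B ∧ x ≠ 0}

@[simp] lemma mem_pts {B : Submodule (ZMod 2) V} {x : V} : x ∈ pts B ↔ x ∈ B ∧ x ≠ 0 := by
  simp [pts]

lemma card_pts (B : Submodule (ZMod 2) V) : #(pts B) + 1 = Nat.card B := by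
  classical
  have h : (pts B) = ({x | x ∈ B} : Finset V).erase 0 := by
    ext x; simp [and_comm]
  rw [h, card_erase_add_one (by simp), Nat.card_eq_fintype_card, Fintype.card_subtype]

lemma W_pts_of_le {B : Submodule (ZMod 2) V} {u : Module.Dual (ZMod 2) V}
    (h : B ≤ LinearMap.ker u) : W (pts B) u + 1 = Nat.card B := by
  rw [← card_pts]
  have : W (pts B) u = ∑ x ∈ pts B, (1 : ℤ) :=
    sum_congr rfl fun x hx => χ_of_eq_zero (h (mem_pts.1 hx).1)
  rw [this]; simp

lemma W_pts_of_not_le {B : Submodule (ZMod 2) V} {u : Module.Dual (ZMod 2) V}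
    (h : ¬ B ≤ LinearMap.ker u) : W (pts B) u + 1 = 0 := by
  classical
  obtain ⟨b, hb, hub⟩ := SetLike.not_le_iff_exists.1 h
  have hB : W (pts B) u + 1 = ∑ x : B, χ (x : V) u := by
    have h : (pts B) = ({x | x ∈ B} : Finset V).erase 0 := by
      ext x; simp [and_comm]
    have h2 := sum_erase_add ({x | x ∈ B} : Finset V) (fun x => χ x u) (a := 0) (by simp)
    rw [W, h, ← χ_zero u, h2]
    exact sum_subtype _ (by simp) _
  have h := Fintype.sum_equiv (Equiv.addRight (⟨b, hb⟩ : B)) (fun x => χ ((x : V) + b) u)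
    (fun x => χ (x : V) u) (fun x => by simp)
  simp only [χ_add, χ_of_ne_zero (show u b ≠ 0 from hub), ← sum_mul] at h
  linarith

lemma zero_notMem_pts (B : Submodule (ZMod 2) V) : (0 : V) ∉ pts B := by simp

lemma W_pts_eq_or (B : Submodule (ZMod 2) V) (u : Module.Dual (ZMod 2) V) :
    W (pts B) u + 1 = Nat.card B ∨ W (pts B) u + 1 = 0 := by
  by_cases h : B ≤ LinearMap.ker u
  · exact .inl (W_pts_of_le h)
  · exact .inr (W_pts_of_not_le h)

lemma W_pts_modEq {F : Submodule (ZMod 2) V} (hF : Nat.card F = 16)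
    (u : Module.Dual (ZMod 2) V) : (16 : ℤ) ∣ W (pts F) u + 1 := by
  rcases W_pts_eq_or F u with h | h <;> rw [h] <;> simp [hF]

/-- The subspace spanned by `K` and one further vector. -/
lemma exists_adjoin (K : Submodule (ZMod 2) V) {s : V} (hs : s ∉ K) :
    ∃ F : Submodule (ZMod 2) V, (∀ x, x ∈ F ↔ x ∈ K ∨ x + s ∈ K) ∧
      Nat.card F = 2 * Nat.card K := by
  classical
  let F : Submodule (ZMod 2) V :=
    { carrier := {x | x ∈ K ∨ x + s ∈ K}
      add_mem' := by
        rintro a b (ha | ha) (hb | hb)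
        · exact .inl (K.add_mem ha hb)
        · exact .inr (by rw [add_assoc]; exact K.add_mem ha hb)
        · exact .inr (by rw [add_right_comm]; exact K.add_mem ha hb)
        · refine .inl ?_
          have : a + b = (a + s) + (b + s) := by
            rw [add_add_add_comm, ZModModule.add_self, add_zero]
          rw [this]; exact K.add_mem ha hb
      zero_mem' := .inl K.zero_mem
      smul_mem' := by
        intro c x hx
        by_cases hc : c = 0
        · simp [hc]
        · simpa [eq_one_of_ne_zero hc] using hx }
  have hF : ∀ x, x ∈ F ↔ x ∈ K ∨ x + s ∈ K := fun x => Iff.rfl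
  refine ⟨F, hF, ?_⟩
  have h1 : ({x | x ∈ F} : Finset V) = ({x | x ∈ K} : Finset V) ∪ ({x | x ∈ K} : Finset V).image
      (· + s) := by
    ext x
    simp only [hF, mem_filter_univ, mem_union, mem_image]
    refine or_congr Iff.rfl ⟨fun h => ⟨x + s, h, add_add_self _ _⟩, ?_⟩
    rintro ⟨y, hy, rfl⟩
    rwa [add_add_self]
  have h2 : Disjoint ({x | x ∈ K} : Finset V) (({x | x ∈ K} : Finset V).image (· + s)) := by
    rw [disjoint_left]
    simp only [mem_filter_univ, mem_image, not_exists, not_and]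
    rintro x hx y hy rfl
    exact hs (by simpa [add_add_self_left] using K.add_mem hy hx)
  rw [Nat.card_eq_fintype_card, Fintype.card_subtype, Nat.card_eq_fintype_card,
    Fintype.card_subtype, h1, card_union_of_disjoint h2,
    card_image_of_injective _ (add_left_injective s)]
  ring

end Points

/-! ### Divisible sets of points -/

section Divisible

variable {V : Type*} [AddCommGroup V] [Module (ZMod 2) V]

/-- A finite set of vectors is `8`-divisible if every hyperplane `ker u` misses a multiple of `8` of
its elements. Since `#T - W T u` is twice the number of missed elements, this is a condition
modulo `16` on the character sums. -/
def IsEightDivisible (T : Finset V) : Prop := ∀ u, (16 : ℤ) ∣ #T - W T u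

/-- The section of an `8`-divisible set with a hyperplane is `4`-divisible. -/
lemma IsEightDivisible.dvd_section {T : Finset V} (hT : IsEightDivisible T)
    (c u : Module.Dual (ZMod 2) V) :
    (8 : ℤ) ∣ #{x ∈ T | c x = 0} - W {x ∈ T | c x = 0} u := by
  have h1 := W_add_W_add T u c
  have h2 := W_add_W_add T 0 c
  rw [W_zero, W_zero, zero_add] at h2
  have := hT u
  have := hT c
  have := hT (u + c)
  omega

variable [Fintype V] [DecidableEq V]

/-- The values of a `4`-divisible character sum avoid the gap between `r - 8` and `r`; comparing the
second moment with this gap bounds the cardinality from below. -/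
lemma IsEightDivisible.le_card_section {T : Finset V} (hT : IsEightDivisible T)
    (h0 : (0 : V) ∉ T) (c : Module.Dual (ZMod 2) V) {r : ℤ}
    (hr : (8 : ℤ) ∣ #{x ∈ T | c x = 0} - r) : r * (8 - r) ≤ #{x ∈ T | c x = 0} := by
  set A : Finset V := {x ∈ T | c x = 0} with hA
  have h0A : (0 : V) ∉ A := by simp [hA, h0]
  have hpos : 0 ≤ ∑ u : Module.Dual (ZMod 2) V, (W A u - r) * (W A u - r + 8) := by
    refine sum_nonneg fun u _ => mul_add_nonneg_of_dvd ?_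
    have := hT.dvd_section c u
    rw [← hA] at this
    omega
  have h1 : ∀ u : Module.Dual (ZMod 2) V, (W A u - r) * (W A u - r + 8) =
      W A u * W A u + (8 - 2 * r) * W A u + r * (r - 8) := fun u => by ring
  simp only [h1, sum_add_distrib, ← mul_sum, sum_W_mul_W, sum_W A h0A, sum_const, card_univ,
    nsmul_eq_mul, inter_self] at hpos
  have hN := card_dual_pos (V := V)
  nlinarith

/-- The eight points of an `8`-divisible set off a hyperplane form an affine solid: a translate
`s + K` of a subspace `K` of the hyperplane with eight elements. -/
lemma IsEightDivisible.exists_affine_solid {T : Finset V} (hT : IsEightDivisible T)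
    (c : Module.Dual (ZMod 2) V) (hc : #{x ∈ T | c x ≠ 0} = 8) :
    ∃ (K : Submodule (ZMod 2) V) (s : V), Nat.card K = 8 ∧
      ∀ x, x + s ∈ K ↔ x ∈ T ∧ c x ≠ 0 := by
  set S : Finset V := {x ∈ T | c x ≠ 0} with hS
  have hmem : ∀ x, x ∈ S ↔ x ∈ T ∧ c x ≠ 0 := by simp [hS]
  have h0S : (0 : V) ∉ S := by simp [hmem]
  have hcS : ∀ {x}, x ∈ S → c x = 1 := fun hx => eq_one_of_ne_zero ((hmem _).1 hx).2
  have hadd : ∀ {x y}, x ∈ S → y ∈ S → x + y ∉ S := by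
    intro x y hx hy hxy
    have := ((hmem _).1 hxy).2
    rw [map_add, hcS hx, hcS hy] at this
    exact this (by decide)
  -- Every other hyperplane misses `0`, `4` or `8` points of `S`.
  have hval : ∀ u, W S u = 8 ∨ W S u = 0 ∨ W S u = -8 := by
    intro u
    have h1 := W_sub_W_add T u c
    rw [← hS] at h1
    have h2 := W_eq_card_sub S u
    have h3 : #{x ∈ S | u x ≠ 0} ≤ 8 := (card_filter_le _ _).trans hc.le
    have := hT u
    have := hT (u + c)
    rw [hc] at h2
    omega
  have hclosed : ∀ {e s t}, e ∈ S → s ∈ S → t ∈ S → e ≠ s → t + (e + s) ∈ S := by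
    intro e s t he hs ht hes
    have hes0 : e + s ≠ 0 := fun h => hes (add_eq_zero_iff.1 h)
    have hzero : ∑ u : Module.Dual (ZMod 2) V,
        (1 - χ e u) * (1 - χ s u) * (W S u * (W S u + 8)) = 0 := by
      refine sum_eq_zero fun u _ => ?_
      rcases hval u with h | h | h
      · have : χ e u = 1 := by
          by_contra hne
          have h2 := W_eq_card_sub S u
          have h3 : 0 < #{x ∈ S | u x ≠ 0} :=
            card_pos.2 ⟨e, by simpa [he] using fun h => hne (χ_of_eq_zero h)⟩
          omega
        simp [this]
      · simp [h]
      · simp [h]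
    have h1 : ∀ u : Module.Dual (ZMod 2) V, (1 - χ e u) * (1 - χ s u) * (W S u * (W S u + 8)) =
        W S u * W S u - χ e u * (W S u * W S u) - χ s u * (W S u * W S u) +
        χ (e + s) u * (W S u * W S u) + 8 * (W S u) - 8 * (χ e u * W S u) - 8 * (χ s u * W S u) +
        8 * (χ (e + s) u * W S u) := fun u => by rw [χ_add]; ring
    simp only [h1, sum_add_distrib, sum_sub_distrib, ← mul_sum, sum_W_mul_W, sum_W S h0S,
      sum_χ_mul_W, sum_χ_mul_W_mul_W, inter_self, hc, he, hs, hadd he hs] at hzero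
    have h2 : ∀ y ∈ S, #{x ∈ S | x + y ∈ S} = 0 := by
      intro y hy
      rw [card_eq_zero, filter_eq_empty_iff]
      exact fun x hx => hadd hx hy
    rw [h2 e he, h2 s hs] at hzero
    have hN := card_dual_pos (V := V)
    have h3 : #{x ∈ S | x + (e + s) ∈ S} = #S := by
      rw [hc]
      simp only [if_true, if_false] at hzero
      have : (Fintype.card (Module.Dual (ZMod 2) V) : ℤ) *
        (#{x ∈ S | x + (e + s) ∈ S} - 8) = 0 := by push_cast at hzero ⊢; linarith
      rcases mul_eq_zero.1 this with h | h
      · omega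
      · omega
    exact card_filter_eq_iff.1 h3 t ht
  obtain ⟨s, hs⟩ : S.Nonempty := card_pos.1 (by omega)
  let K : Submodule (ZMod 2) V :=
    { carrier := {x | x + s ∈ S}
      add_mem' := by
        intro a b ha hb
        by_cases hab : b = 0
        · simpa [hab] using ha
        · have := hclosed hb hs ha (fun h => hab (by simpa using h))
          rw [add_add_self] at this
          change a + b + s ∈ S
          rwa [add_right_comm]
      zero_mem' := by simpa using hs
      smul_mem' := by
        intro r x hx
        by_cases hr : r = 0
        · simpa [hr] using hs
        · simpa [eq_one_of_ne_zero hr] using hx }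
  have hK : ∀ x, x ∈ K ↔ x + s ∈ S := fun x => Iff.rfl
  refine ⟨K, s, ?_, fun x => by rw [hK, add_add_self, hmem]⟩
  classical
  rw [Nat.card_eq_fintype_card, Fintype.card_subtype, ← hc]
  refine card_bij (fun x _ => x + s) (fun x hx => ?_) (fun x _ y _ h => add_right_cancel h)
    (fun y hy => ⟨y + s, ?_, add_add_self _ _⟩)
  · simpa [hK] using hx
  · simpa [hK, add_add_self] using hy

end Divisible

/-! ### Extending an affine solid to a solid -/

section FortyFive

variable {V : Type*} [AddCommGroup V] [Module (ZMod 2) V] [Fintype V] [DecidableEq V]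

/-- A hyperplane misses at most `24` points of an `8`-divisible set of `45` points. -/
lemma IsEightDivisible.neg_three_le {T : Finset V} (hT : IsEightDivisible T) (h0 : (0 : V) ∉ T)
    (h45 : #T = 45) (u : Module.Dual (ZMod 2) V) : -3 ≤ W T u := by
  by_contra! h
  have h1 := hT u
  have h2 := W_add_W_add T 0 u
  rw [W_zero, W_zero, zero_add] at h2
  have := hT.le_card_section h0 u (r := 5) (by omega)
  omega

/-- A hyperplane misses at most `16` points of an `8`-divisible set of `30` points. -/
lemma IsEightDivisible.neg_two_le {T : Finset V} (hT : IsEightDivisible T) (h0 : (0 : V) ∉ T)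
    (h30 : #T = 30) (u : Module.Dual (ZMod 2) V) : -2 ≤ W T u := by
  by_contra! h
  have h1 := hT u
  have h2 := W_add_W_add T 0 u
  rw [W_zero, W_zero, zero_add] at h2
  have := hT.le_card_section h0 u (r := 6) (by omega)
  omega

lemma IsEightDivisible.sdiff_pts {T : Finset V} (hT : IsEightDivisible T)
    {F : Submodule (ZMod 2) V} (hF : Nat.card F = 16) (hFT : pts F ⊆ T) :
    IsEightDivisible (T \ pts F) := by
  intro u
  have h1 := W_pts_modEq hF u
  have h2 := card_pts F
  have h3 := card_sdiff_add_card_eq_card hFT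
  rw [W_sdiff hFT]
  have := hT u
  omega

/-- An affine solid `s + K` inside an `8`-divisible set of `45` points which is missed by a
hyperplane that does not miss the largest possible number of points extends to a solid
inside the set. The mean of `W T` over the functionals that vanish on `K` but not at `s` shows that
at most one point of `K` lies outside `T`. If there were one, `x` say, then the second moment over
the functionals not vanishing at `x` of the signed indicator function of `T` minus the solid would
be too small. -/
lemma IsEightDivisible.exists_solid {T : Finset V} (hT : IsEightDivisible T) (h0 : (0 : V) ∉ T)
    (h45 : #T = 45) {K : Submodule (ZMod 2) V} (hK : Nat.card K = 8) {s : V}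
    (hsT : ∀ k ∈ K, k + s ∈ T) {c : Module.Dual (ZMod 2) V} (hcK : K ≤ LinearMap.ker c)
    (hcs : c s ≠ 0) (hcT : W T c ≠ -3) :
    ∃ F : Submodule (ZMod 2) V, Nat.card F = 16 ∧ pts F ⊆ T := by
  have hN := card_dual_pos (V := V)
  have hsK : s ∉ K := fun h => hcs (hcK h)
  have hlow := hT.neg_three_le h0 h45
  have hcardK : #(pts K) = 7 := by have := card_pts K; omega
  have h6 : 6 ≤ #(pts K ∩ T) := by
    have hpos : 0 < ∑ u : Module.Dual (ZMod 2) V,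
        (1 - χ s u) * (1 + W (pts K) u) * (W T u + 3) := by
      refine sum_pos' (fun u _ => ?_) ⟨c, mem_univ _, ?_⟩
      · refine mul_nonneg (mul_nonneg ?_ ?_) (by linarith [hlow u])
        · rcases χ_eq_or s u with h | h <;> rw [h] <;> norm_num
        · rcases W_pts_eq_or K u with h | h <;> omega
      · rw [χ_of_ne_zero hcs, add_comm 1, W_pts_of_le hcK, hK]
        have := hlow c
        have : 0 < W T c + 3 := by omega
        push_cast; linarith
    have h1 : ∀ u : Module.Dual (ZMod 2) V, (1 - χ s u) * (1 + W (pts K) u) * (W T u + 3) =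
        W T u + 3 + W (pts K) u * W T u + 3 * W (pts K) u - χ s u * W T u - 3 * χ s u -
        χ s u * (W (pts K) u * W T u) - 3 * (χ s u * W (pts K) u) := fun u => by ring
    have h2 : #{x ∈ pts K | x + s ∈ T} = 7 := by
      rw [← hcardK, card_filter_eq_iff]
      exact fun x hx => hsT x (mem_pts.1 hx).1
    have hs0 : s ≠ 0 := fun h => hsK (h ▸ K.zero_mem)
    have hsT' : s ∈ T := by simpa using hsT 0 K.zero_mem
    simp only [h1, sum_add_distrib, sum_sub_distrib, ← mul_sum, sum_W_mul_W, sum_W T h0,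
      sum_W _ (zero_notMem_pts K), sum_χ_mul_W, sum_χ_mul_W_mul_W, sum_χ, hs0, hsT', mem_pts, hsK,
      h2, sum_const, card_univ, nsmul_eq_mul, if_true, if_false, false_and] at hpos
    have : 0 < (Fintype.card (Module.Dual (ZMod 2) V) : ℤ) * (#(pts K ∩ T) - 5) := by
      push_cast at hpos ⊢; linarith
    have := pos_of_mul_pos_right this hN.le
    omega
  obtain ⟨F, hF, hFcard⟩ := exists_adjoin K hsK
  rw [hK] at hFcard
  refine ⟨F, hFcard, ?_⟩
  by_contra hFT
  -- `T` contains all points of `F` except one, called `x`.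
  obtain ⟨x, hxF, hxT⟩ := not_subset.1 hFT
  have hxK : x ∈ pts K := by
    rw [mem_pts] at hxF ⊢
    refine ⟨((hF x).1 hxF.1).resolve_right fun h => hxT ?_, hxF.2⟩
    simpa [add_add_self] using hsT _ h
  have hx0 : x ≠ 0 := (mem_pts.1 hxF).2
  have hKT : ∀ y ∈ pts K, y ∉ T → y = x := by
    intro y hy hyT
    by_contra hyx
    have h1 : pts K ∩ T ⊆ ((pts K).erase x).erase y := by
      intro z hz
      rw [mem_inter] at hz
      exact mem_erase.2 ⟨fun h => hyT (h ▸ hz.2), mem_erase.2 ⟨fun h => hxT (h ▸ hz.2), hz.1⟩⟩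
    have h2 := card_le_card h1
    rw [card_erase_of_mem (mem_erase.2 ⟨hyx, hy⟩), card_erase_of_mem hxK] at h2
    omega
  have hFx : (pts F).erase x ⊆ T := by
    intro y hy
    obtain ⟨hyx, hy⟩ := mem_erase.1 hy
    rw [mem_pts] at hy
    rcases (hF y).1 hy.1 with h | h
    · by_contra hyT
      exact hyx (hKT y (mem_pts.2 ⟨h, hy.2⟩) hyT)
    · simpa [add_add_self] using hsT _ h
  set R : Finset V := T \ (pts F).erase x with hR
  have h0R : (0 : V) ∉ R := fun h => h0 (mem_sdiff.1 h).1
  have hxR : x ∉ R := fun h => hxT (mem_sdiff.1 h).1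
  have hRcard : #R = 31 := by
    have h1 := card_sdiff_add_card_eq_card hFx
    rw [← hR, card_erase_of_mem hxF] at h1
    have := card_pts F
    omega
  have hWR : ∀ u, W R u = W T u - W (pts F) u + χ x u := by
    intro u
    rw [hR, W_sdiff hFx]
    have := add_sum_erase (pts F) (fun y => χ y u) hxF
    simp only [W] at this ⊢
    linarith
  have hneg : 0 ≤ ∑ u : Module.Dual (ZMod 2) V,
      (1 - χ x u) * ((W R u - χ x u - 14) * (W R u - χ x u - 14 + 16)) := by
    refine sum_nonneg fun u _ => mul_nonneg ?_ (mul_add_nonneg_of_dvd ?_)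
    · rcases χ_eq_or x u with h | h <;> rw [h] <;> norm_num
    · rw [hWR]
      have := hT u
      have := W_pts_modEq hFcard u
      omega
  have hsq : ∀ u : Module.Dual (ZMod 2) V, χ x u * χ x u = 1 := by
    intro u; rcases χ_eq_or x u with h | h <;> rw [h] <;> norm_num
  -- On the functionals with `χ x u = -1` the factor `W R u - χ x u` is `W R u + 1`.
  have h1 : ∀ u : Module.Dual (ZMod 2) V,
      (1 - χ x u) * ((W R u - χ x u - 14) * (W R u - χ x u - 14 + 16)) =
      W R u * W R u - χ x u * (W R u * W R u) + (-10) * W R u + 10 * (χ x u * W R u) +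
      39 * χ x u - 39 := by
    intro u
    linear_combination ((2 * W R u - 12 + 1) - χ x u) * hsq u
  simp only [h1, sum_add_distrib, sum_sub_distrib, ← mul_sum, sum_W_mul_W, sum_W R h0R,
    sum_χ_mul_W, sum_χ_mul_W_mul_W, sum_χ, hx0, hxR, inter_self, hRcard, sum_const, card_univ,
    nsmul_eq_mul, if_false] at hneg
  have : 0 ≤ (Fintype.card (Module.Dual (ZMod 2) V) : ℤ) * (-8 - #{y ∈ R | y + x ∈ R}) := by
    push_cast at hneg ⊢; linarith
  have := nonneg_of_mul_nonneg_right this hN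
  omega

end FortyFive

/-! ### Sets of 45 points that contain a solid -/

section ThreeSolids

variable {V : Type*} [AddCommGroup V] [Module (ZMod 2) V] [Fintype V] [DecidableEq V]

/-- An `8`-divisible set of `30` points contains a solid. The starting point is a hyperplane missing
exactly eight points; these form an affine solid, and the mean of `W R` over the functionals that
do not vanish at two of them shows that the sum of the two lies in the set. -/
lemma IsEightDivisible.exists_solid_of_card_thirty {R : Finset V} (hR : IsEightDivisible R)
    (h0 : (0 : V) ∉ R) (h30 : #R = 30) :
    ∃ F : Submodule (ZMod 2) V, Nat.card F = 16 ∧ pts F ⊆ R := by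
  have hN := card_dual_pos (V := V)
  have hlow := hR.neg_two_le h0 h30
  obtain ⟨c, hc⟩ : ∃ c, W R c = 14 := by
    by_contra! hne
    have hzero : ∑ u : Module.Dual (ZMod 2) V, (W R u - 30) * (W R u + 2) = 0 := by
      refine sum_eq_zero fun u _ => ?_
      have h1 := hR u
      have h2 := hlow u
      have h3 := hne u
      have h4 := W_eq_card_sub R u
      rcases (by omega : W R u = 30 ∨ W R u = -2) with h | h <;> simp [h]
    have h1 : ∀ u : Module.Dual (ZMod 2) V, (W R u - 30) * (W R u + 2) =
        W R u * W R u + (-28) * W R u - 60 := fun u => by ring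
    simp only [h1, sum_add_distrib, sum_sub_distrib, ← mul_sum, sum_W_mul_W, sum_W R h0, inter_self,
      h30, sum_const, card_univ, nsmul_eq_mul] at hzero
    push_cast at hzero
    linarith
  have hc8 : #{x ∈ R | c x ≠ 0} = 8 := by
    have := W_eq_card_sub R c
    omega
  obtain ⟨K, s, hK, hKs⟩ := hR.exists_affine_solid c hc8
  have hadd : ∀ p q, p ∈ R → q ∈ R → c p ≠ 0 → c q ≠ 0 → p ≠ q → p + q ∈ R := by
    intro p q hp hq hcp hcq hpq
    by_contra hpqR
    have hpos : 0 < ∑ u : Module.Dual (ZMod 2) V, (1 - χ p u) * (1 - χ q u) * (W R u + 2) := by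
      refine sum_pos' (fun u _ => ?_) ⟨c, mem_univ _, ?_⟩
      · refine mul_nonneg (mul_nonneg ?_ ?_) (by linarith [hlow u])
        · rcases χ_eq_or p u with h | h <;> rw [h] <;> norm_num
        · rcases χ_eq_or q u with h | h <;> rw [h] <;> norm_num
      · rw [χ_of_ne_zero hcp, χ_of_ne_zero hcq, hc]; norm_num
    have h1 : ∀ u : Module.Dual (ZMod 2) V, (1 - χ p u) * (1 - χ q u) * (W R u + 2) =
        W R u + 2 - χ p u * W R u - 2 * χ p u - χ q u * W R u - 2 * χ q u +
        χ (p + q) u * W R u + 2 * χ (p + q) u := fun u => by rw [χ_add]; ring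
    have hp0 : p ≠ 0 := fun h => h0 (h ▸ hp)
    have hq0 : q ≠ 0 := fun h => h0 (h ▸ hq)
    have hpq0 : p + q ≠ 0 := fun h => hpq (add_eq_zero_iff.1 h)
    simp only [h1, sum_add_distrib, sum_sub_distrib, ← mul_sum, sum_W R h0, sum_χ_mul_W, sum_χ,
      hp0, hq0, hpq0, hp, hq, hpqR, sum_const, card_univ, nsmul_eq_mul, if_true, if_false] at hpos
    linarith
  have hsK : s ∉ K := fun h => h0 ((hKs 0).1 (by simpa using h)).1
  obtain ⟨F, hF, hFcard⟩ := exists_adjoin K hsK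
  refine ⟨F, by omega, fun x hx => ?_⟩
  rw [mem_pts, hF] at hx
  rcases hx with ⟨hx | hx, hx0⟩
  · have h1 := (hKs (x + s)).1 (by rwa [add_add_self])
    have h2 := (hKs s).1 (by rw [ZModModule.add_self]; exact K.zero_mem)
    have := hadd _ _ h1.1 h2.1 h1.2 h2.2 (fun h => hx0 (by simpa using h))
    rwa [add_add_self] at this
  · exact ((hKs x).1 hx).1

/-- An `8`-divisible set of `15` points consists of the points of a solid: every
hyperplane misses at most eight of them, and the mean of `W R + 1` over the functionals that do not
vanish at two given points shows that the set is closed under addition. -/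
lemma IsEightDivisible.exists_pts_eq_of_card_fifteen {R : Finset V} (hR : IsEightDivisible R)
    (h0 : (0 : V) ∉ R) (h15 : #R = 15) :
    ∃ F : Submodule (ZMod 2) V, Nat.card F = 16 ∧ pts F = R := by
  have hN := card_dual_pos (V := V)
  have hadd : ∀ p q, p ∈ R → q ∈ R → p ≠ q → p + q ∈ R := by
    intro p q hp hq hpq
    by_contra hpqR
    have hnn : 0 ≤ ∑ u : Module.Dual (ZMod 2) V, (1 - χ p u) * (1 - χ q u) * (W R u + 1) := by
      refine sum_nonneg fun u _ => mul_nonneg (mul_nonneg ?_ ?_) ?_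
      · rcases χ_eq_or p u with h | h <;> rw [h] <;> norm_num
      · rcases χ_eq_or q u with h | h <;> rw [h] <;> norm_num
      · have h1 := hR u
        have h2 := W_eq_card_sub R u
        have h3 := card_filter_le R (fun x => u x ≠ 0)
        omega
    have h1 : ∀ u : Module.Dual (ZMod 2) V, (1 - χ p u) * (1 - χ q u) * (W R u + 1) =
        W R u + 1 - χ p u * W R u - χ p u - χ q u * W R u - χ q u +
        χ (p + q) u * W R u + χ (p + q) u := fun u => by rw [χ_add]; ring
    have hp0 : p ≠ 0 := fun h => h0 (h ▸ hp)
    have hq0 : q ≠ 0 := fun h => h0 (h ▸ hq)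
    have hpq0 : p + q ≠ 0 := fun h => hpq (add_eq_zero_iff.1 h)
    simp only [h1, sum_add_distrib, sum_sub_distrib, sum_W R h0, sum_χ_mul_W, sum_χ,
      hp0, hq0, hpq0, hp, hq, hpqR, sum_const, card_univ, nsmul_eq_mul, if_true, if_false] at hnn
    linarith
  let F : Submodule (ZMod 2) V :=
    { carrier := {x | x ∈ R ∨ x = 0}
      add_mem' := by
        rintro a b (ha | rfl) (hb | rfl)
        · by_cases hab : a = b
          · exact .inr (add_eq_zero_iff.2 hab)
          · exact .inl (hadd a b ha hb hab)
        · simpa using Or.inl ha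
        · simpa using Or.inl hb
        · simp
      zero_mem' := .inr rfl
      smul_mem' := by
        intro r x hx
        by_cases hr : r = 0
        · simp [hr]
        · simpa [eq_one_of_ne_zero hr] using hx }
  have hF : pts F = R := by
    ext x
    rw [mem_pts]
    change (x ∈ R ∨ x = 0) ∧ x ≠ 0 ↔ x ∈ R
    exact ⟨fun h => h.1.resolve_right h.2, fun h => ⟨.inl h, fun hx => h0 (hx ▸ h)⟩⟩
  exact ⟨F, by rw [← card_pts, hF, h15], hF⟩

lemma disjoint_of_disjoint_pts {A B : Submodule (ZMod 2) V} (h : Disjoint (pts A) (pts B)) :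
    Disjoint A B := by
  rw [Submodule.disjoint_def]
  intro x hA hB
  by_contra hx
  exact disjoint_left.1 h (mem_pts.2 ⟨hA, hx⟩) (mem_pts.2 ⟨hB, hx⟩)

/-- An `8`-divisible set of `45` points that contains a solid is the union of three disjoint
solids. -/
lemma IsEightDivisible.exists_three_solids {T : Finset V} (hT : IsEightDivisible T)
    (h0 : (0 : V) ∉ T) (h45 : #T = 45) {F₁ : Submodule (ZMod 2) V} (hF₁ : Nat.card F₁ = 16)
    (hF₁T : pts F₁ ⊆ T) :
    ∃ F₂ F₃ : Submodule (ZMod 2) V, Nat.card F₂ = 16 ∧ Nat.card F₃ = 16 ∧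
      Disjoint F₁ F₂ ∧ Disjoint F₁ F₃ ∧ Disjoint F₂ F₃ ∧
      ∀ x ∈ T, x ∈ F₁ ∨ x ∈ F₂ ∨ x ∈ F₃ := by
  have hR := hT.sdiff_pts hF₁ hF₁T
  set R := T \ pts F₁ with hRdef
  have h0R : (0 : V) ∉ R := fun h => h0 (mem_sdiff.1 h).1
  have hRcard : #R = 30 := by
    have h1 := card_sdiff_add_card_eq_card hF₁T
    rw [← hRdef] at h1
    have := card_pts F₁
    omega
  obtain ⟨F₂, hF₂, hF₂R⟩ := hR.exists_solid_of_card_thirty h0R hRcard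
  have hQ := hR.sdiff_pts hF₂ hF₂R
  set Q := R \ pts F₂ with hQdef
  have h0Q : (0 : V) ∉ Q := fun h => h0R (mem_sdiff.1 h).1
  have hQcard : #Q = 15 := by
    have h1 := card_sdiff_add_card_eq_card hF₂R
    rw [← hQdef] at h1
    have := card_pts F₂
    omega
  obtain ⟨F₃, hF₃, hF₃Q⟩ := hQ.exists_pts_eq_of_card_fifteen h0Q hQcard
  refine ⟨F₂, F₃, hF₂, hF₃, disjoint_of_disjoint_pts ?_, disjoint_of_disjoint_pts ?_,
    disjoint_of_disjoint_pts ?_, fun x hx => ?_⟩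
  · exact disjoint_sdiff.mono_right hF₂R
  · rw [hF₃Q]; exact disjoint_sdiff.mono_right sdiff_subset
  · rw [hF₃Q]; exact disjoint_sdiff
  · by_cases h1 : x ∈ pts F₁
    · exact .inl (mem_pts.1 h1).1
    by_cases h2 : x ∈ pts F₂
    · exact .inr (.inl (mem_pts.1 h2).1)
    · have : x ∈ pts F₃ := by rw [hF₃Q]; exact mem_sdiff.2 ⟨mem_sdiff.2 ⟨hx, h1⟩, h2⟩
      exact .inr (.inr (mem_pts.1 this).1)

end ThreeSolids

/-! ### Configurations of four-element words -/

section Plane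

variable {V : Type*} [AddCommGroup V] [Module (ZMod 2) V]

/-- Four vectors with sum zero: the fourth is the sum of the other three. -/
lemma add_add_mem_of_sum_eq_zero [DecidableEq V] {w : Finset V} (hw : #w = 4)
    (hsum : ∑ x ∈ w, x = 0) {a b c : V}
    (ha : a ∈ w) (hb : b ∈ w) (hc : c ∈ w) (hab : a ≠ b) (hac : a ≠ c) (hbc : b ≠ c) :
    a + b + c ∈ w := by
  have hb' : b ∈ w.erase a := mem_erase.2 ⟨hab.symm, hb⟩
  have hc' : c ∈ (w.erase a).erase b := mem_erase.2 ⟨hbc.symm, mem_erase.2 ⟨hac.symm, hc⟩⟩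
  have h1 : #(((w.erase a).erase b).erase c) = 1 := by
    rw [card_erase_of_mem hc', card_erase_of_mem hb', card_erase_of_mem ha, hw]
  obtain ⟨y, hy⟩ := card_eq_one.1 h1
  have hyw : y ∈ w := by
    have : y ∈ ((w.erase a).erase b).erase c := by simp [hy]
    exact mem_of_mem_erase (mem_of_mem_erase (mem_of_mem_erase this))
  rw [← add_sum_erase w _ ha, ← add_sum_erase _ _ hb', ← add_sum_erase _ _ hc', hy, sum_singleton]
    at hsum
  have : a + b + c = y := by
    rw [← add_eq_zero_iff, ← hsum]; abel
  rwa [this]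

/-- If neither `u` nor `v` vanishes identically on the plane `E`, then `u` is non-zero at four points
of `E`, and `v` is non-zero at two or at all four of these. -/
lemma card_filter_plane [Fintype V] {E : Submodule (ZMod 2) V} (hE : Nat.card E = 8)
    {u v : Module.Dual (ZMod 2) V} (hu : ¬ E ≤ LinearMap.ker u) (hv : ¬ E ≤ LinearMap.ker v) :
    #{x ∈ pts E | u x ≠ 0} = 4 ∧ (#{x ∈ {x ∈ pts E | u x ≠ 0} | v x ≠ 0} = 2 ∨
      #{x ∈ {x ∈ pts E | u x ≠ 0} | v x ≠ 0} = 4) := by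
  have h7 := card_pts E
  have h1 := W_pts_of_not_le hu
  have h2 := W_pts_of_not_le hv
  have h3 := W_pts_eq_or E (v + u)
  have h4 := W_sub_W_add (pts E) v u
  have h5 := W_eq_card_sub (pts E) u
  have h6 := W_eq_card_sub {x ∈ pts E | u x ≠ 0} v
  omega

/-- The core of the case in which no hyperplane misses exactly eight points. Here `D` is the set of
points off a hyperplane, and `𝒲` consists of four-element subsets of `D` through a fixed point `e` of
`D ∩ E`; they have sum zero, meet each other in an even number of points, and meet
`A = D ∩ E` in two points unless they are equal to it. -/
lemma exists_three_words [DecidableEq V] {T D A : Finset V} {e : V} {𝒲 : Finset (Finset V)}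
    (hDT : D ⊆ T) (heA : e ∈ A) (hA : #A = 4)
    (hnb : ∀ a ∈ A, a ≠ e → ∃ B : Finset V, #B = 6 ∧ (∀ x ∈ B, x ∈ T ∧ x + (e + a) ∈ T) ∧
      B ∩ D ⊆ A)
    (hle : ∀ a ∈ A, a ≠ e → #{x ∈ T | x + (e + a) ∈ T} ≤ 16)
    (hW7 : 7 ≤ #𝒲) (hWe : ∀ w ∈ 𝒲, e ∈ w) (hWD : ∀ w ∈ 𝒲, w ⊆ D) (hW4 : ∀ w ∈ 𝒲, #w = 4)
    (hWsum : ∀ w ∈ 𝒲, ∑ x ∈ w, x = 0) (hWW : ∀ w ∈ 𝒲, ∀ w' ∈ 𝒲, Even #(w ∩ w'))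
    (hWA : ∀ w ∈ 𝒲, #(A ∩ w) = 2 ∨ #(A ∩ w) = 4) :
    ∃ w₁ ∈ 𝒲, ∃ w₂ ∈ 𝒲, ∃ w₃ ∈ 𝒲, ∃ a ∈ A, ∃ b ∈ A, a ≠ e ∧ b ≠ e ∧ a ≠ b ∧ w₁ ∩ w₂ = {e, a} ∧
      A ∩ w₁ = {e, a} ∧ A ∩ w₂ = {e, a} ∧ A ∩ w₃ = {e, b} := by
  set 𝒲' := 𝒲.erase A with hW'
  have h6 : 6 ≤ #𝒲' := by
    have := pred_card_le_card_erase (s := 𝒲) (a := A)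
    rw [← hW'] at this
    omega
  have hmem : ∀ w ∈ 𝒲', w ∈ 𝒲 ∧ #(A ∩ w) = 2 := by
    intro w hw
    obtain ⟨hne, hw⟩ := mem_erase.1 hw
    refine ⟨hw, (hWA w hw).resolve_right fun h => hne ?_⟩
    have h1 : A ∩ w = A := eq_of_subset_of_card_le inter_subset_left (by omega)
    have h2 : A ∩ w = w := eq_of_subset_of_card_le inter_subset_right (by rw [hW4 w hw]; omega)
    rw [← h2, h1]
  have hpair : ∀ {a : V}, a ≠ e → ∀ w ∈ 𝒲', a ∈ A → a ∈ w → A ∩ w = {e, a} := by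
    intro a hae w hw ha haw
    refine (eq_of_subset_of_card_le ?_ ?_).symm
    · simp [insert_subset_iff, heA, hWe w (hmem w hw).1, ha, haw]
    · rw [(hmem w hw).2, card_pair hae.symm]
  have hmeet : ∀ {a : V}, a ≠ e → ∀ w ∈ 𝒲', ∀ w' ∈ 𝒲', a ∈ w → a ∈ w' → w ≠ w' →
      w ∩ w' = {e, a} := by
    intro a hae w hw w' hw' ha ha' hne
    have hw0 := (hmem w hw).1
    have hw0' := (hmem w' hw').1
    refine (eq_of_subset_of_card_le ?_ ?_).symm
    · simp [insert_subset_iff, hWe w hw0, hWe w' hw0', ha, ha']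
    · rw [card_pair hae.symm]
      have h1 : #(w ∩ w') < 4 := by
        rw [← hW4 w hw0]
        refine card_lt_card (inter_subset_left.ssubset_of_ne fun h => hne ?_)
        exact eq_of_subset_of_card_le (inter_eq_left.1 h) (by rw [hW4 w hw0, hW4 w' hw0'])
      obtain ⟨k, hk⟩ := hWW w hw0 w' hw0'
      omega
  -- At most five of the words in `𝒲'` contain a given point `a ≠ e` of `A`: the other points of these
  -- words are distinct, and together with six points of the plane they lie on lines through `e + a`.
  have h5 : ∀ a ∈ A, a ≠ e → #{w ∈ 𝒲' | a ∈ w} ≤ 5 := by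
    intro a ha hae
    obtain ⟨B, hB6, hBT, hBD⟩ := hnb a ha hae
    set U := ({w ∈ 𝒲' | a ∈ w} : Finset (Finset V)).biUnion (fun w => w \ A) with hU
    have hUcard : #U = #{w ∈ 𝒲' | a ∈ w} * 2 := by
      rw [hU, card_biUnion, sum_const_nat]
      · intro w hw
        obtain ⟨hw, haw⟩ := mem_filter.1 hw
        have h1 := card_sdiff_add_card_inter w A
        rw [inter_comm, (hmem w hw).2, hW4 w (hmem w hw).1] at h1
        omega
      · intro w hw w' hw' hne
        obtain ⟨hw, haw⟩ := mem_filter.1 hw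
        obtain ⟨hw', haw'⟩ := mem_filter.1 hw'
        refine disjoint_left.2 fun x hx hx' => ?_
        rw [mem_sdiff] at hx hx'
        have : x ∈ w ∩ w' := mem_inter.2 ⟨hx.1, hx'.1⟩
        rw [hmeet hae w hw w' hw' haw haw' hne] at this
        rcases mem_insert.1 this with rfl | h
        · exact hx.2 heA
        · exact hx.2 (mem_singleton.1 h ▸ ha)
    have hUD : ∀ x ∈ U, x ∈ D ∧ x ∉ A ∧ x + (e + a) ∈ T := by
      intro x hx
      obtain ⟨w, hw, hxw⟩ := mem_biUnion.1 hx
      obtain ⟨hw, haw⟩ := mem_filter.1 hw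
      obtain ⟨hxw, hxA⟩ := mem_sdiff.1 hxw
      have hw0 := (hmem w hw).1
      refine ⟨hWD w hw0 hxw, hxA, hDT (hWD w hw0 ?_)⟩
      have h1 := add_add_mem_of_sum_eq_zero (hW4 w hw0) (hWsum w hw0) (hWe w hw0) haw hxw hae.symm
        (fun h => hxA (h ▸ heA)) (fun h => hxA (h ▸ ha))
      rwa [add_comm] at h1
    have hdisj : Disjoint U B := by
      rw [disjoint_left]
      exact fun x hxU hxB => (hUD x hxU).2.1 (hBD (mem_inter.2 ⟨hxB, (hUD x hxU).1⟩))
    have hsub : U ∪ B ⊆ ({x ∈ T | x + (e + a) ∈ T} : Finset V) := by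
      intro x hx
      rw [mem_filter]
      rcases mem_union.1 hx with h | h
      · exact ⟨hDT (hUD x h).1, (hUD x h).2.2⟩
      · exact hBT x h
    have h1 := card_le_card hsub
    rw [card_union_of_disjoint hdisj, hUcard, hB6] at h1
    have := hle a ha hae
    omega
  have hcover : ∀ w ∈ 𝒲', ∃ a ∈ A, a ≠ e ∧ a ∈ w := by
    intro w hw
    have h1 : 1 < #(A ∩ w) := by rw [(hmem w hw).2]; norm_num
    obtain ⟨a, ha, hae⟩ := exists_mem_ne h1 e
    exact ⟨a, (mem_inter.1 ha).1, hae, (mem_inter.1 ha).2⟩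
  obtain ⟨a, ha, h2⟩ : ∃ a ∈ A.erase e, 1 < #{w ∈ 𝒲' | a ∈ w} := by
    by_contra! hall
    have h1 : 𝒲' ⊆ (A.erase e).biUnion (fun a => {w ∈ 𝒲' | a ∈ w}) := by
      intro w hw
      obtain ⟨a, ha, hae, haw⟩ := hcover w hw
      exact mem_biUnion.2 ⟨a, mem_erase.2 ⟨hae, ha⟩, mem_filter.2 ⟨hw, haw⟩⟩
    have h2 := (card_le_card h1).trans (card_biUnion_le_card_mul _ _ 1 hall)
    rw [card_erase_of_mem heA] at h2
    omega
  obtain ⟨hae, ha⟩ := mem_erase.1 ha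
  obtain ⟨w₁, hw₁, w₂, hw₂, hne⟩ := one_lt_card.1 h2
  obtain ⟨hw₁, haw₁⟩ := mem_filter.1 hw₁
  obtain ⟨hw₂, haw₂⟩ := mem_filter.1 hw₂
  obtain ⟨w₃, hw₃, haw₃⟩ : ∃ w ∈ 𝒲', a ∉ w := by
    by_contra! hall
    have := h5 a ha hae
    rw [filter_true_of_mem hall] at this
    omega
  obtain ⟨b, hb, hbe, hbw⟩ := hcover w₃ hw₃
  exact ⟨w₁, (hmem _ hw₁).1, w₂, (hmem _ hw₂).1, w₃, (hmem _ hw₃).1, a, ha, b, hb, hae, hbe,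
    fun h => haw₃ (h ▸ hbw), hmeet hae w₁ hw₁ w₂ hw₂ haw₁ haw₂ hne, hpair hae w₁ hw₁ ha haw₁,
    hpair hae w₂ hw₂ ha haw₂, hpair hbe w₃ hw₃ hb hbw⟩

variable [Fintype V] [DecidableEq V]

/-- A point of an `8`-divisible set of `45` points lies on at most eight lines contained in the
set. -/
lemma IsEightDivisible.card_neighbors_le {T : Finset V} (hT : IsEightDivisible T)
    (h0 : (0 : V) ∉ T) (h45 : #T = 45) {p : V} (hp : p ∈ T) : #{x ∈ T | x + p ∈ T} ≤ 16 := by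
  have hN := card_dual_pos (V := V)
  have hnn : 0 ≤ ∑ u : Module.Dual (ZMod 2) V,
      (1 - χ p u) * ((W T u - 13) * (W T u - 13 + 16)) := by
    refine sum_nonneg fun u _ => mul_nonneg ?_ (mul_add_nonneg_of_dvd ?_)
    · rcases χ_eq_or p u with h | h <;> rw [h] <;> norm_num
    · have := hT u
      omega
  have h1 : ∀ u : Module.Dual (ZMod 2) V, (1 - χ p u) * ((W T u - 13) * (W T u - 13 + 16)) =
      W T u * W T u - 10 * W T u - 39 - χ p u * (W T u * W T u) + 10 * (χ p u * W T u) +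
      39 * χ p u := fun u => by ring
  have hp0 : p ≠ 0 := fun h => h0 (h ▸ hp)
  simp only [h1, sum_add_distrib, sum_sub_distrib, ← mul_sum, sum_W_mul_W, sum_W T h0,
    sum_χ_mul_W, sum_χ_mul_W_mul_W, sum_χ, hp0, hp, inter_self, h45, sum_const, card_univ,
    nsmul_eq_mul, if_true, if_false] at hnn
  have : 0 ≤ (Fintype.card (Module.Dual (ZMod 2) V) : ℤ) * (16 - #{x ∈ T | x + p ∈ T}) := by
    push_cast at hnn ⊢; linarith
  have := nonneg_of_mul_nonneg_right this hN
  omega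

end Plane

/-! ### A plane forces a solid -/

section PlaneInside

variable {V : Type*} [AddCommGroup V] [Module (ZMod 2) V] [Fintype V] [DecidableEq V]

/-- If no hyperplane misses exactly eight points of an `8`-divisible set `T` of `45` points, then the
set spans a space of dimension eight: its annihilator has index `256`. -/
lemma card_annihilator {T : Finset V} (h0 : (0 : V) ∉ T)
    (h45 : #T = 45) (hval : ∀ u, W T u = 45 ∨ W T u = 13 ∨ W T u = -3) :
    256 * #{u : Module.Dual (ZMod 2) V | W T u = 45} = Fintype.card (Module.Dual (ZMod 2) V) := by
  have hsum : ∑ u : Module.Dual (ZMod 2) V, (W T u - 13) * (W T u + 3) =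
      ∑ u : Module.Dual (ZMod 2) V, if W T u = 45 then (1536 : ℤ) else 0 :=
    sum_congr rfl fun u _ => by rcases hval u with h | h | h <;> simp [h]
  have h1 : ∀ u : Module.Dual (ZMod 2) V, (W T u - 13) * (W T u + 3) =
      W T u * W T u - 10 * W T u - 39 := fun u => by ring
  simp only [h1, sum_sub_distrib, ← mul_sum, sum_W_mul_W, sum_W T h0, inter_self,
    h45, sum_const, card_univ, nsmul_eq_mul, ← sum_filter] at hsum
  push_cast at hsum
  omega

/-- An `8`-divisible set of `45` points that contains a plane contains a solid, provided that no
hyperplane misses exactly eight points.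

Let `u₀` miss `16` points, among them points of the plane `E`, let `D` be the set of these `16` points
and `e ∈ D ∩ E`. The second moment of `W D` over the functionals not vanishing at `e` shows that at
least seven four-element subsets of `D` containing `e` have the form `{x ∈ D | v x ≠ 0}`. Three of
them form, together with `E`, an affine solid. -/
lemma IsEightDivisible.exists_solid_of_plane_aux {T : Finset V} (hT : IsEightDivisible T)
    (h0 : (0 : V) ∉ T) (h45 : #T = 45) {E : Submodule (ZMod 2) V} (hE : Nat.card E = 8)
    (hET : pts E ⊆ T) (hval : ∀ u, W T u = 45 ∨ W T u = 13 ∨ W T u = -3) :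
    ∃ F : Submodule (ZMod 2) V, Nat.card F = 16 ∧ pts F ⊆ T := by
  have hN := card_dual_pos (V := V)
  have hM := card_annihilator h0 h45 hval
  set Z : Finset (Module.Dual (ZMod 2) V) := {u | W T u = 45} with hZ
  have hmemZ : ∀ u, u ∈ Z ↔ W T u = 45 := by simp [hZ]
  have hvan : ∀ u, W T u = 45 → ∀ x ∈ T, u x = 0 := by
    intro u hu x hx
    by_contra hne
    have h1 := W_eq_card_sub T u
    have h2 : 0 < #{x ∈ T | u x ≠ 0} := card_pos.2 ⟨x, by simp [hx, hne]⟩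
    omega
  have hE7 := card_pts E
  obtain ⟨u₀, hu₀E, hu₀⟩ : ∃ u₀, ¬ E ≤ LinearMap.ker u₀ ∧ W T u₀ = 13 := by
    by_contra! hall
    have hzero : ∑ u : Module.Dual (ZMod 2) V, (8 - (W (pts E) u + 1)) * (W T u + 3) = 0 := by
      refine sum_eq_zero fun u _ => ?_
      by_cases hu : E ≤ LinearMap.ker u
      · rw [W_pts_of_le hu, hE]; norm_num
      · have h1 : W T u = -3 := by
          rcases hval u with h | h | h
          · refine absurd (fun x hx => ?_) hu
            by_cases hx0 : x = 0
            · simp [hx0]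
            · exact hvan u h x (hET (mem_pts.2 ⟨hx, hx0⟩))
          · exact absurd h (hall u hu)
          · exact h
        rw [h1]; norm_num
    have h1 : ∀ u : Module.Dual (ZMod 2) V, (8 - (W (pts E) u + 1)) * (W T u + 3) =
        7 * W T u + 21 - W (pts E) u * W T u - 3 * W (pts E) u := fun u => by ring
    simp only [h1, sum_sub_distrib, sum_add_distrib, ← mul_sum, sum_W_mul_W, sum_W T h0,
      sum_W _ (zero_notMem_pts E), inter_eq_left.2 hET, sum_const, card_univ,
      nsmul_eq_mul, (by omega : #(pts E) = 7)] at hzero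
    push_cast at hzero
    linarith
  set D : Finset V := {x ∈ T | u₀ x ≠ 0} with hD
  have hDT : D ⊆ T := filter_subset _ _
  have hmemD : ∀ x, x ∈ D ↔ x ∈ T ∧ u₀ x ≠ 0 := by simp [hD]
  have h0D : (0 : V) ∉ D := by simp [hmemD]
  have hD16 : #D = 16 := by
    have := W_eq_card_sub T u₀
    rw [← hD] at this
    omega
  have hWD : ∀ v, W T v - W T (v + u₀) = 2 * W D v := fun v => W_sub_W_add T v u₀
  have hWDval : ∀ v, W D v = 16 ∨ W D v = 8 ∨ W D v = 0 ∨ W D v = -8 ∨ W D v = -16 := by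
    intro v
    have h1 := hWD v
    have h2 := W_eq_card_sub D v
    have h3 := card_filter_le D (fun x => v x ≠ 0)
    rcases hval v with h | h | h <;> rcases hval (v + u₀) with h' | h' | h' <;> omega
  set A : Finset V := {x ∈ pts E | u₀ x ≠ 0} with hA
  have hmemA : ∀ x, x ∈ A ↔ x ∈ E ∧ u₀ x ≠ 0 := by
    intro x
    rw [hA, mem_filter, mem_pts]
    exact ⟨fun h => ⟨h.1.1, h.2⟩, fun h => ⟨⟨h.1, fun hx => h.2 (by simp [hx])⟩, h.2⟩⟩
  have hAD : A ⊆ D := fun x hx =>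
    (hmemD x).2 ⟨hET (mem_filter.1 hx).1, (mem_filter.1 hx).2⟩
  have hA4 : #A = 4 := (card_filter_plane hE hu₀E hu₀E).1
  obtain ⟨e, heA⟩ : A.Nonempty := card_pos.1 (by omega)
  have heD := hAD heA
  obtain ⟨heE, hue⟩ := (hmemA e).1 heA
  have hadd : ∀ {x y}, x ∈ D → y ∈ D → x + y ∉ D := by
    intro x y hx hy hxy
    have := ((hmemD _).1 hxy).2
    rw [map_add, eq_one_of_ne_zero ((hmemD _).1 hx).2,
      eq_one_of_ne_zero ((hmemD _).1 hy).2] at this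
    exact this (by decide)
  -- The functionals that miss four points of `D`, among them `e`, and the corresponding four-sets.
  set X : Finset (Module.Dual (ZMod 2) V) := {v | W D v = 8 ∧ v e ≠ 0} with hX
  set word : Module.Dual (ZMod 2) V → Finset V := fun v => {x ∈ D | v x ≠ 0} with hword
  set 𝒲 := X.image word with h𝒲
  have hX7 : 7 * #Z ≤ #X := by
    set Y : Finset (Module.Dual (ZMod 2) V) := {v | W D v = -16} with hY
    have hYZ : #Y ≤ #Z := by
      refine card_le_card_of_injOn (fun v => v + u₀) (fun v hv => ?_)
        (fun v _ w _ h => add_right_cancel h)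
      have h1 : W D v = -16 := by simpa [hY] using hv
      have h2 := hWD v
      rw [h1] at h2
      refine (hmemZ _).2 ?_
      rcases hval v with h | h | h <;> rcases hval (v + u₀) with h' | h' | h' <;> omega
    have hsum : ∑ v : Module.Dual (ZMod 2) V, (1 - χ e v) * (W D v * (W D v + 8)) =
        ∑ v : Module.Dual (ZMod 2) V, ((if W D v = 8 ∧ v e ≠ 0 then (256 : ℤ) else 0) +
          if W D v = -16 then (256 : ℤ) else 0) := by
      refine sum_congr rfl fun v _ => ?_
      have h2 := W_eq_card_sub D v
      by_cases hve : v e = 0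
      · have h1 : W D v ≠ -16 := by
          intro h
          have h3 : #{x ∈ D | v x ≠ 0} = #D := by omega
          exact card_filter_eq_iff.1 h3 e heD hve
        simp [χ_of_eq_zero hve, hve, h1]
      · have h1 : W D v ≠ 16 := by
          intro h
          have h3 : 0 < #{x ∈ D | v x ≠ 0} := card_pos.2 ⟨e, by simp [heD, hve]⟩
          omega
        rw [χ_of_ne_zero hve]
        rcases hWDval v with h | h | h | h | h
        · exact absurd h h1
        all_goals simp [h, hve]
    have h1 : ∀ v : Module.Dual (ZMod 2) V, (1 - χ e v) * (W D v * (W D v + 8)) =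
        W D v * W D v - χ e v * (W D v * W D v) + 8 * W D v - 8 * (χ e v * W D v) :=
      fun v => by ring
    have h2 : #{x ∈ D | x + e ∈ D} = 0 := by
      rw [card_eq_zero, filter_eq_empty_iff]
      exact fun x hx => hadd hx heD
    simp only [h1, sum_sub_distrib, sum_add_distrib, ← mul_sum, sum_W_mul_W, sum_W D h0D,
      sum_χ_mul_W, sum_χ_mul_W_mul_W, heD, h2, inter_self, hD16, ← sum_filter, sum_const,
      nsmul_eq_mul, if_true] at hsum
    rw [← hX, ← hY] at hsum
    push_cast at hsum
    omega
  have hW7 : 7 ≤ #𝒲 := by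
    have h1 : #X ≤ #Z * #𝒲 := by
      refine card_le_mul_card_image X _ fun w hw => ?_
      obtain ⟨v₁, hv₁, hv₁w⟩ := mem_image.1 hw
      refine card_le_card_of_injOn (fun v => v + v₁) (fun v hv => ?_)
        (fun v _ w _ h => add_right_cancel h)
      obtain ⟨-, hvw⟩ := mem_filter.1 hv
      have hagree : ∀ x ∈ D, (v + v₁) x = 0 := by
        intro x hx
        have h2 : x ∈ word v ↔ x ∈ word v₁ := by rw [hvw, hv₁w]
        simp only [hword, mem_filter, hx, true_and, ne_eq, not_iff_not] at h2
        rw [LinearMap.add_apply]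
        by_cases h3 : v x = 0
        · rw [h3, h2.1 h3, add_zero]
        · rw [eq_one_of_ne_zero h3, eq_one_of_ne_zero (fun h => h3 (h2.2 h))]; decide
      have h3 : W D (v + v₁) = 16 := by
        rw [W, sum_congr rfl fun x hx => χ_of_eq_zero (hagree x hx)]
        simp [hD16]
      have h4 := hWD (v + v₁)
      refine (hmemZ _).2 ?_
      rcases hval (v + v₁) with h | h | h <;>
        rcases hval (v + v₁ + u₀) with h' | h' | h' <;> omega
    have hZpos : 0 < #Z := card_pos.2 ⟨0, (hmemZ 0).2 (by rw [W_zero, h45]; rfl)⟩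
    have : #Z * 7 ≤ #Z * #𝒲 := by linarith
    exact Nat.le_of_mul_le_mul_left this hZpos
  have hmem𝒲 : ∀ w ∈ 𝒲, ∃ v, v e ≠ 0 ∧ W D v = 8 ∧ w = {x ∈ D | v x ≠ 0} := by
    intro w hw
    obtain ⟨v, hv, rfl⟩ := mem_image.1 hw
    have := (mem_filter.1 hv).2
    exact ⟨v, this.2, this.1, rfl⟩
  have hW4 : ∀ w ∈ 𝒲, #w = 4 := by
    intro w hw
    obtain ⟨v, -, hv, rfl⟩ := hmem𝒲 w hw
    have := W_eq_card_sub D v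
    omega
  -- The intersection of three supports is even.
  have heven : ∀ w ∈ 𝒲, ∀ v : Module.Dual (ZMod 2) V, Even #{x ∈ w | v x ≠ 0} := by
    intro w hw v
    have h1 := hW4 w hw
    obtain ⟨v', -, hv', rfl⟩ := hmem𝒲 w hw
    have h2 := W_sub_W_add D v v'
    have h3 := W_eq_card_sub {x ∈ D | v' x ≠ 0} v
    rw [Nat.even_iff]
    rcases hWDval v with h | h | h | h | h <;> rcases hWDval (v + v') with h' | h' | h' | h' | h' <;>
      omega
  have hWsum : ∀ w ∈ 𝒲, ∑ x ∈ w, x = 0 := by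
    intro w hw
    refine (Module.forall_dual_apply_eq_zero_iff (ZMod 2) _).1 fun v => ?_
    have h1 : v (∑ x ∈ w, x) = ∑ x ∈ w, if v x ≠ 0 then 1 else 0 := by
      rw [map_sum]
      refine sum_congr rfl fun x _ => ?_
      split_ifs with h
      · exact eq_one_of_ne_zero h
      · simpa using h
    rw [h1, sum_boole]
    exact (ZMod.natCast_eq_zero_iff_even).2 (heven w hw v)
  have hnb : ∀ a ∈ A, a ≠ e → ∃ B : Finset V, #B = 6 ∧ (∀ x ∈ B, x ∈ T ∧ x + (e + a) ∈ T) ∧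
      B ∩ D ⊆ A := by
    intro a ha hae
    have haE := ((hmemA a).1 ha).1
    have hpE : e + a ∈ E := E.add_mem heE haE
    have hp0 : e + a ≠ 0 := fun h => hae (add_eq_zero_iff.1 h).symm
    refine ⟨(pts E).erase (e + a), ?_, fun x hx => ?_, fun x hx => ?_⟩
    · rw [card_erase_of_mem (mem_pts.2 ⟨hpE, hp0⟩)]; omega
    · obtain ⟨hxp, hx⟩ := mem_erase.1 hx
      refine ⟨hET hx, hET (mem_pts.2 ⟨E.add_mem (mem_pts.1 hx).1 hpE, fun h => hxp ?_⟩)⟩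
      exact add_eq_zero_iff.1 h
    · obtain ⟨hxE, hxD⟩ := mem_inter.1 hx
      exact (hmemA x).2 ⟨(mem_pts.1 (mem_of_mem_erase hxE)).1, ((hmemD x).1 hxD).2⟩
  have hle : ∀ a ∈ A, a ≠ e → #{x ∈ T | x + (e + a) ∈ T} ≤ 16 := by
    intro a ha hae
    refine hT.card_neighbors_le h0 h45 (hET (mem_pts.2 ⟨E.add_mem heE ((hmemA a).1 ha).1, ?_⟩))
    exact fun h => hae (add_eq_zero_iff.1 h).symm
  have hWe : ∀ w ∈ 𝒲, e ∈ w := by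
    intro w hw
    obtain ⟨v, hve, -, rfl⟩ := hmem𝒲 w hw
    simp [heD, hve]
  have hsubD : ∀ w ∈ 𝒲, w ⊆ D := by
    intro w hw
    obtain ⟨v, -, -, rfl⟩ := hmem𝒲 w hw
    exact filter_subset _ _
  have hWW : ∀ w ∈ 𝒲, ∀ w' ∈ 𝒲, Even #(w ∩ w') := by
    intro w hw w' hw'
    obtain ⟨v', -, -, rfl⟩ := hmem𝒲 w' hw'
    have h1 : w ∩ ({x ∈ D | v' x ≠ 0} : Finset V) = {x ∈ w | v' x ≠ 0} := by
      obtain ⟨v, -, -, rfl⟩ := hmem𝒲 w hw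
      ext x; simp only [mem_inter, mem_filter]; tauto
    rw [h1]
    exact heven w hw v'
  have hWA : ∀ w ∈ 𝒲, #(A ∩ w) = 2 ∨ #(A ∩ w) = 4 := by
    intro w hw
    obtain ⟨v, hve, -, rfl⟩ := hmem𝒲 w hw
    have h1 : A ∩ ({x ∈ D | v x ≠ 0} : Finset V) = {x ∈ A | v x ≠ 0} := by
      ext x
      simp only [mem_inter, mem_filter]
      exact ⟨fun h => ⟨h.1, h.2.2⟩, fun h => ⟨h.1, hAD h.1, h.2⟩⟩
    rw [h1]
    exact (card_filter_plane hE hu₀E (fun h => hve (h heE))).2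
  obtain ⟨w₁, hw₁, w₂, hw₂, w₃, hw₃, a, ha, b, hb, hae, hbe, hab, h12, hA1, hA2, hA3⟩ :=
    exists_three_words hDT heA hA4 hnb hle hW7 hWe hsubD hW4 hWsum hWW hWA
  -- `w₃` meets `w₁` and `w₂` outside `A`, in `t` and `s`.
  have hew : ∀ {w c}, A ∩ w = {e, c} → e ∈ w ∧ c ∈ w := by
    intro w c h
    have h1 : e ∈ A ∩ w := by simp [h]
    have h2 : c ∈ A ∩ w := by simp [h]
    exact ⟨(mem_inter.1 h1).2, (mem_inter.1 h2).2⟩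
  have hthird : ∀ w ∈ 𝒲, A ∩ w = {e, a} → ∃ t ∈ w₃, t ∈ w ∧ t ∉ A := by
    intro w hw hAw
    have h2 : 0 < #(w₃ ∩ w) := card_pos.2 ⟨e, mem_inter.2 ⟨(hew hA3).1, (hew hAw).1⟩⟩
    obtain ⟨k, hk⟩ := hWW w₃ hw₃ w hw
    obtain ⟨t, ht, hte⟩ := exists_mem_ne (s := w₃ ∩ w) (by omega) e
    obtain ⟨ht3, htw⟩ := mem_inter.1 ht
    refine ⟨t, ht3, htw, fun htA => ?_⟩
    have h3 : t ∈ A ∩ w := mem_inter.2 ⟨htA, htw⟩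
    have h4 : t ∈ A ∩ w₃ := mem_inter.2 ⟨htA, ht3⟩
    rw [hAw] at h3
    rw [hA3] at h4
    simp only [mem_insert, mem_singleton, hte, false_or] at h3 h4
    exact hab (h3.symm.trans h4)
  obtain ⟨t, ht3, ht1, htA⟩ := hthird w₁ hw₁ hA1
  obtain ⟨s, hs3, hs2, hsA⟩ := hthird w₂ hw₂ hA2
  have hts : t ≠ s := by
    rintro rfl
    have h1 : t ∈ w₁ ∩ w₂ := mem_inter.2 ⟨ht1, hs2⟩
    rw [h12] at h1
    rcases mem_insert.1 h1 with rfl | h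
    · exact htA heA
    · exact htA (mem_singleton.1 h ▸ ha)
  have hne : ∀ {x y}, x ∉ A → y ∈ A → y ≠ x := fun hx hy h => hx (h ▸ hy)
  have hsw : s = e + b + t := by
    have h1 := add_add_mem_of_sum_eq_zero (hW4 w₃ hw₃) (hWsum w₃ hw₃) (hew hA3).1 (hew hA3).2 ht3
      hbe.symm (hne htA heA) (hne htA hb)
    have h2 := add_add_mem_of_sum_eq_zero (hW4 w₃ hw₃) (hWsum w₃ hw₃) (hew hA3).1 ht3 hs3
      (hne htA heA) (hne hsA heA) hts
    by_contra hsne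
    have h3 : ({e, b, t, s, e + b + t} : Finset V) ⊆ w₃ := by
      simp [insert_subset_iff, (hew hA3).1, (hew hA3).2, ht3, hs3, h1]
    have h4 := card_le_card h3
    have h5 : e + b + t ≠ e := fun h => hne htA hb (by
      have : e + (b + t) = e := by rwa [← add_assoc]
      exact add_eq_zero_iff.1 (by simpa using this))
    have h6 : e + b + t ≠ b := fun h => hne htA heA (by
      have : b + (e + t) = b := by rwa [← add_assoc, add_comm b e]
      exact add_eq_zero_iff.1 (by simpa using this))
    have h7 : e + b + t ≠ t := fun h => hbe (by
      have : e + b = 0 := by simpa using h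
      exact (add_eq_zero_iff.1 this).symm)
    rw [hW4 w₃ hw₃, card_insert_of_notMem, card_insert_of_notMem, card_insert_of_notMem,
      card_pair hsne] at h4
    · omega
    · simp [hts, h7.symm]
    · simp [hne htA hb, hne hsA hb, h6.symm]
    · simp [hbe.symm, hne htA heA, hne hsA heA, h5.symm]
  have ht1' := add_add_mem_of_sum_eq_zero (hW4 w₁ hw₁) (hWsum w₁ hw₁) (hew hA1).1 (hew hA1).2 ht1
      hae.symm (hne htA heA) (hne htA ha)
  have hs2' := add_add_mem_of_sum_eq_zero (hW4 w₂ hw₂) (hWsum w₂ hw₂) (hew hA2).1 (hew hA2).2 hs2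
      hae.symm (hne hsA heA) (hne hsA ha)
  -- The eight points `e`, `a`, `b`, `e + a + b`, `t`, `e + a + t`, `e + b + t`, `a + b + t` of `D`
  -- form an affine solid.
  have hcA : e + a + b ∈ A := by
    rw [hmemA] at ha hb ⊢
    refine ⟨E.add_mem (E.add_mem heE ha.1) hb.1, ?_⟩
    rw [map_add, map_add, eq_one_of_ne_zero hue, eq_one_of_ne_zero ha.2, eq_one_of_ne_zero hb.2]
    decide
  obtain ⟨K₁, hK₁, hK₁c⟩ := exists_adjoin (⊥ : Submodule (ZMod 2) V) (s := e + a)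
    (fun h => hae (add_eq_zero_iff.1 ((Submodule.mem_bot _).1 h)).symm)
  have hK₁' : ∀ x, x ∈ K₁ ↔ x = 0 ∨ x = e + a := by
    intro x; rw [hK₁, Submodule.mem_bot, Submodule.mem_bot, add_eq_zero_iff]
  obtain ⟨K₂, hK₂, hK₂c⟩ := exists_adjoin K₁ (s := e + b) (by
    rw [hK₁']
    rintro (h | h)
    · exact hbe (add_eq_zero_iff.1 h).symm
    · exact hab (add_left_cancel h).symm)
  have hK₂A : ∀ x ∈ K₂, x + e ∈ A := by
    intro x hx
    rw [hK₂, hK₁', hK₁'] at hx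
    have h1 : ∀ {y z : V}, y + z = e + a → y = z + (e + a) := fun h => by
      rw [← h, add_comm, add_add_self]
    rcases hx with (rfl | rfl) | (h | h)
    · simpa using heA
    · rwa [add_right_comm, ZModModule.add_self, zero_add]
    · rw [add_eq_zero_iff.1 h, add_right_comm, ZModModule.add_self, zero_add]; exact hb
    · rw [h1 h]
      have : e + b + (e + a) + e = e + a + b + (e + e) := by abel
      rw [this, ZModModule.add_self, add_zero]; exact hcA
  obtain ⟨K, hK, hKc⟩ := exists_adjoin K₂ (s := t + e) (fun h => htA (by
    have := hK₂A _ h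
    rwa [add_add_self] at this))
  have hK8 : Nat.card K = 8 := by
    rw [hKc, hK₂c, hK₁c]; simp
  have hKD : ∀ k ∈ K, k + e ∈ D := by
    intro k hk
    rcases (hK k).1 hk with h | h
    · exact hAD (hK₂A k h)
    · have h1 : k + e = (k + (t + e)) + t := by
        rw [← add_assoc, add_assoc (k + t), add_comm e t, ← add_assoc, add_add_self]
      rw [h1]
      generalize k + (t + e) = x at h
      rw [hK₂, hK₁', hK₁'] at h
      rcases h with (rfl | rfl) | (h | h)
      · rw [zero_add]; exact hsubD _ hw₁ ht1
      · exact hsubD _ hw₁ ht1'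
      · rw [add_eq_zero_iff.1 h, ← hsw]; exact hsubD _ hw₂ hs2
      · have h2 : x = (e + a) + (e + b) := by rw [← h, add_add_self]
        rw [h2, add_assoc, ← hsw]; exact hsubD _ hw₂ hs2'
  refine hT.exists_solid h0 h45 hK8 (s := e) (fun k hk => hDT (hKD k hk)) (c := u₀) (fun k hk => ?_)
    hue (by rw [hu₀]; norm_num)
  have h1 := eq_one_of_ne_zero ((hmemD _).1 (hKD k hk)).2
  rw [map_add, eq_one_of_ne_zero hue] at h1
  simpa using h1

/-- An `8`-divisible set of `45` points that contains a plane contains a solid. -/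
lemma IsEightDivisible.exists_solid_of_plane {T : Finset V} (hT : IsEightDivisible T)
    (h0 : (0 : V) ∉ T) (h45 : #T = 45) {E : Submodule (ZMod 2) V} (hE : Nat.card E = 8)
    (hET : pts E ⊆ T) : ∃ F : Submodule (ZMod 2) V, Nat.card F = 16 ∧ pts F ⊆ T := by
  by_cases h29 : ∃ c, W T c = 29
  · obtain ⟨c, hc⟩ := h29
    have hc8 : #{x ∈ T | c x ≠ 0} = 8 := by
      have := W_eq_card_sub T c
      omega
    obtain ⟨K, s, hK, hKs⟩ := hT.exists_affine_solid c hc8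
    have hs := (hKs s).1 (by rw [ZModModule.add_self]; exact K.zero_mem)
    have hks : ∀ k ∈ K, k + s ∈ T ∧ c (k + s) ≠ 0 := fun k hk =>
      (hKs (k + s)).1 (by rwa [add_add_self])
    refine hT.exists_solid h0 h45 hK (fun k hk => (hks k hk).1) (c := c) (fun k hk => ?_) hs.2
      (by rw [hc]; norm_num)
    have h1 := eq_one_of_ne_zero (hks k hk).2
    rw [map_add, eq_one_of_ne_zero hs.2] at h1
    simpa using h1
  · push Not at h29
    refine hT.exists_solid_of_plane_aux h0 h45 hE hET fun u => ?_
    have h1 := hT u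
    have h2 := hT.neg_three_le h0 h45 u
    have h3 := h29 u
    have h4 := W_eq_card_sub T u
    omega

end PlaneInside

/-! ### Lines and planes in three disjoint solids -/

section Counting

variable {V : Type*} [AddCommGroup V] [Module (ZMod 2) V] [Fintype V]

lemma eq_of_le_of_card_eq {A B : Submodule (ZMod 2) V} (h : A ≤ B)
    (hc : Nat.card A = Nat.card B) : A = B := by
  have h1 : pts A ⊆ pts B := fun x hx => mem_pts.2 ⟨h (mem_pts.1 hx).1, (mem_pts.1 hx).2⟩
  have hA := card_pts A
  have hB := card_pts B
  have h2 : pts A = pts B := eq_of_subset_of_card_le h1 (by omega)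
  refine le_antisymm h fun x hx => ?_
  by_cases hx0 : x = 0
  · rw [hx0]; exact A.zero_mem
  · have : x ∈ pts A := by rw [h2]; exact mem_pts.2 ⟨hx, hx0⟩
    exact (mem_pts.1 this).1

lemma card_mul_card_le_of_disjoint {A B C : Submodule (ZMod 2) V} (hA : A ≤ C) (hB : B ≤ C)
    (h : Disjoint A B) : Nat.card A * Nat.card B ≤ Nat.card C := by
  rw [← Nat.card_prod]
  refine Nat.card_le_card_of_injective
    (fun x : A × B => (⟨x.1 + x.2, C.add_mem (hA x.1.2) (hB x.2.2)⟩ : C)) ?_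
  rintro ⟨⟨a, ha⟩, ⟨b, hb⟩⟩ ⟨⟨a', ha'⟩, ⟨b', hb'⟩⟩ hab
  have h1 : a + b = a' + b' := congrArg Subtype.val hab
  have h2 : a - a' = b' - b := by rw [sub_eq_sub_iff_add_eq_add, h1, add_comm]
  have h3 : a - a' = 0 :=
    Submodule.disjoint_def.1 h _ (A.sub_mem ha ha') (h2 ▸ B.sub_mem hb' hb)
  have h4 : b' - b = 0 := h2 ▸ h3
  simp [sub_eq_zero.1 h3, sub_eq_zero.1 h4]

lemma disjoint_pts {A B : Submodule (ZMod 2) V} (h : Disjoint A B) :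
    Disjoint (pts A) (pts B) := by
  rw [disjoint_left]
  intro x hA hB
  exact (mem_pts.1 hA).2 (Submodule.disjoint_def.1 h x (mem_pts.1 hA).1 (mem_pts.1 hB).1)

variable [DecidableEq V]

/-- A line with two points in a subspace lies in it. -/
lemma line_le {L F : Submodule (ZMod 2) V} (hL : Nat.card L = 4) (h : 1 < #(pts L ∩ pts F)) :
    L ≤ F := by
  obtain ⟨x, hx, y, hy, hxy⟩ := one_lt_card.1 h
  simp only [mem_inter, mem_pts] at hx hy
  have h1 : ({x, y, x + y} : Finset V) ⊆ pts L := by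
    simp only [insert_subset_iff, singleton_subset_iff, mem_pts]
    exact ⟨hx.1, hy.1, L.add_mem hx.1.1 hy.1.1, fun h => hxy (add_eq_zero_iff.1 h)⟩
  have h2 : #({x, y, x + y} : Finset V) = 3 := by
    refine card_eq_three.2 ⟨x, y, x + y, hxy, fun h => hy.1.2 ?_, fun h => hx.1.2 ?_, rfl⟩
    · simpa using h
    · simpa using h
  have h3 := eq_of_subset_of_card_le h1 (by have := card_pts L; omega)
  intro z hz
  by_cases hz0 : z = 0
  · rw [hz0]; exact F.zero_mem
  have h4 : z ∈ ({x, y, x + y} : Finset V) := by rw [h3]; exact mem_pts.2 ⟨hz, hz0⟩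
  simp only [mem_insert, mem_singleton] at h4
  rcases h4 with rfl | rfl | rfl
  · exact hx.2.1
  · exact hy.2.1
  · exact F.add_mem hx.2.1 hy.2.1

lemma sum_card_pts_inter_le {𝓛 : Finset (Submodule (ZMod 2) V)}
    (hdis : (𝓛 : Set (Submodule (ZMod 2) V)).PairwiseDisjoint id) (U : Finset V) :
    ∑ L ∈ 𝓛, #(pts L ∩ U) ≤ #U := by
  rw [← card_biUnion]
  · exact card_le_card (biUnion_subset.2 fun L _ => inter_subset_right)
  · intro L hL L' hL' hne
    exact (disjoint_pts (hdis hL hL' hne)).mono inter_subset_left inter_subset_left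

/-- A plane contained in the union of three disjoint solids lies in one of them. -/
lemma plane_le_of_three_solids {E F₁ F₂ F₃ : Submodule (ZMod 2) V} (hE : Nat.card E = 8)
    (h12 : Disjoint F₁ F₂) (h13 : Disjoint F₁ F₃) (h23 : Disjoint F₂ F₃)
    (h : ∀ x ∈ E, x ≠ 0 → x ∈ F₁ ∨ x ∈ F₂ ∨ x ∈ F₃) : E ≤ F₁ ∨ E ≤ F₂ ∨ E ≤ F₃ := by
  by_contra! hne
  have hle : ∀ F : Submodule (ZMod 2) V, ¬ E ≤ F →
      Nat.card ↥(E ⊓ F) ≤ 4 ∧ #(pts (E ⊓ F)) + 1 = Nat.card ↥(E ⊓ F) := by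
    intro F hF
    refine ⟨?_, card_pts _⟩
    have h1 : Nat.card ↥(E ⊓ F) ∣ 8 :=
      hE ▸ AddSubgroup.card_dvd_of_le (H := (E ⊓ F).toAddSubgroup) (K := E.toAddSubgroup)
        (fun _ h => h.1)
    have h2 : Nat.card ↥(E ⊓ F) ≠ 8 := fun h => hF (by
      have := eq_of_le_of_card_eq (inf_le_left : E ⊓ F ≤ E) (by rw [h, hE])
      exact inf_eq_left.1 this)
    have h3 := Nat.le_of_dvd (by norm_num) h1
    generalize Nat.card ↥(E ⊓ F) = n at *
    interval_cases n <;> omega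
  have hmul : ∀ F F' : Submodule (ZMod 2) V, Disjoint F F' →
      Nat.card ↥(E ⊓ F) * Nat.card ↥(E ⊓ F') ≤ 8 := fun F F' hFF => hE ▸
    card_mul_card_le_of_disjoint inf_le_left inf_le_left (hFF.mono inf_le_right inf_le_right)
  have hcov : pts E ⊆ pts (E ⊓ F₁) ∪ (pts (E ⊓ F₂) ∪ pts (E ⊓ F₃)) := by
    intro x hx
    simp only [mem_union, mem_pts, Submodule.mem_inf] at hx ⊢
    have := h x hx.1 hx.2
    tauto
  have h1 := (card_le_card hcov).trans ((card_union_le _ _).trans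
    (Nat.add_le_add_left (card_union_le _ _) _))
  have h2 := card_pts E
  obtain ⟨ha, ha'⟩ := hle F₁ hne.1
  obtain ⟨hb, hb'⟩ := hle F₂ hne.2.1
  obtain ⟨hc, hc'⟩ := hle F₃ hne.2.2
  have hab := hmul F₁ F₂ h12
  have hac := hmul F₁ F₃ h13
  have hbc := hmul F₂ F₃ h23
  generalize Nat.card ↥(E ⊓ F₁) = a at *
  generalize Nat.card ↥(E ⊓ F₂) = b at *
  generalize Nat.card ↥(E ⊓ F₃) = c at *
  interval_cases a <;> interval_cases b <;> omega

open Classical in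
/-- Disjoint lines in the union of three disjoint solids that avoid a plane `E` of the first one:
lines in the second solid count twice, those in the third do not count, and the other ones count
once. The latter have one point in each solid, so that a functional vanishing on `E` and on the
third solid, but not on the first, does not vanish at their point in the second solid. There it is
non-zero at eight points only, two of them on each line of the second solid that is not in its
kernel; and the kernel contains at most one of the lines. -/
lemma weighted_card_lines_le {E F₁ F₂ F₃ : Submodule (ZMod 2) V} (hE : Nat.card E = 8)
    (hF₁ : Nat.card F₁ = 16) (hF₂ : Nat.card F₂ = 16) (h12 : Disjoint F₁ F₂)
    (h13 : Disjoint F₁ F₃) (hEF : E ≤ F₁) {𝓛 : Finset (Submodule (ZMod 2) V)}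
    (hdis : (𝓛 : Set (Submodule (ZMod 2) V)).PairwiseDisjoint id) (h4 : ∀ L ∈ 𝓛, Nat.card L = 4)
    (hLE : ∀ L ∈ 𝓛, Disjoint L E)
    (hLF : ∀ L ∈ 𝓛, ∀ x ∈ L, x ≠ 0 → x ∈ F₁ ∨ x ∈ F₂ ∨ x ∈ F₃) :
    ∑ L ∈ 𝓛, (if L ≤ F₂ then 2 else if L ≤ F₃ then 0 else 1) ≤ 10 := by
  obtain ⟨x₀, hx₀F, hx₀E⟩ : ∃ x ∈ F₁, x ∉ E := by
    by_contra! hall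
    have := le_antisymm hEF hall
    rw [this] at hE
    omega
  have hx₀ : x₀ ∉ E ⊔ F₃ := by
    intro h
    obtain ⟨y, hy, z, hz, hyz⟩ := Submodule.mem_sup.1 h
    have h1 : z ∈ F₁ := by
      have : z = x₀ - y := by rw [← hyz, add_sub_cancel_left]
      rw [this]; exact F₁.sub_mem hx₀F (hEF hy)
    have h2 := Submodule.disjoint_def.1 h13 z h1 hz
    exact hx₀E (by rwa [← hyz, h2, add_zero])
  obtain ⟨u, hux₀, hu⟩ := Submodule.exists_le_ker_of_notMem hx₀
  have huE : ∀ x ∈ E, u x = 0 := fun x hx => hu (Submodule.mem_sup_left hx)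
  have huF₃ : ∀ x ∈ F₃, u x = 0 := fun x hx => hu (Submodule.mem_sup_right hx)
  have huF₁ : ∀ x ∈ F₁, x ∉ E → u x ≠ 0 := by
    obtain ⟨G, hG, hGc⟩ := exists_adjoin E hx₀E
    have hGF : G ≤ F₁ := by
      intro x hx
      rcases (hG x).1 hx with h | h
      · exact hEF h
      · have := F₁.add_mem (hEF h) hx₀F
        rwa [add_add_self] at this
    have hGF' := eq_of_le_of_card_eq hGF (by rw [hGc, hE, hF₁])
    intro x hx hxE h
    rw [← hGF'] at hx
    have h1 := huE _ (((hG x).1 hx).resolve_left hxE)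
    rw [map_add, h, zero_add] at h1
    exact hux₀ h1
  have htrans : ∀ L ∈ 𝓛, ¬ L ≤ F₂ → ¬ L ≤ F₃ → ∃ x ∈ pts L, x ∈ pts F₂ ∧ u x ≠ 0 := by
    intro L hL hL2 hL3
    have hL1 : ¬ L ≤ F₁ := by
      intro h
      have := card_mul_card_le_of_disjoint h hEF (hLE L hL)
      rw [h4 L hL, hE, hF₁] at this
      omega
    have hcov : pts L ⊆ (pts L ∩ pts F₁) ∪ ((pts L ∩ pts F₂) ∪ (pts L ∩ pts F₃)) := by
      intro x hx
      have h1 := hLF L hL x (mem_pts.1 hx).1 (mem_pts.1 hx).2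
      have h2 := (mem_pts.1 hx).2
      simp only [mem_union, mem_inter, mem_pts] at hx ⊢
      tauto
    have h1 := (card_le_card hcov).trans ((card_union_le _ _).trans
      (Nat.add_le_add_left (card_union_le _ _) _))
    have h2 := card_pts L
    rw [h4 L hL] at h2
    have hc1 := not_lt.1 fun h => hL1 (line_le (h4 L hL) h)
    have hc2 := not_lt.1 fun h => hL2 (line_le (h4 L hL) h)
    have hc3 := not_lt.1 fun h => hL3 (line_le (h4 L hL) h)
    obtain ⟨x, hx⟩ := card_pos.1 (show 0 < #(pts L ∩ pts F₁) by omega)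
    obtain ⟨y, hy⟩ := card_pos.1 (show 0 < #(pts L ∩ pts F₂) by omega)
    simp only [mem_inter, mem_pts] at hx hy
    have hxy : x + y ≠ 0 := fun h => hx.1.2
      (Submodule.disjoint_def.1 h12 x hx.2.1 (add_eq_zero_iff.1 h ▸ hy.2.1))
    have h3 : x + y ∈ F₃ := by
      rcases hLF L hL (x + y) (L.add_mem hx.1.1 hy.1.1) hxy with h | h | h
      · have := (F₁.add_mem_iff_right hx.2.1).1 h
        exact absurd (Submodule.disjoint_def.1 h12 y this hy.2.1) hy.1.2
      · have := (F₂.add_mem_iff_left hy.2.1).1 h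
        exact absurd (Submodule.disjoint_def.1 h12 x hx.2.1 this) hx.1.2
      · exact h
    have hxE : x ∉ E := fun h => hx.1.2 (Submodule.disjoint_def.1 (hLE L hL) x hx.1.1 h)
    have h5 := huF₁ x hx.2.1 hxE
    have h6 := huF₃ _ h3
    refine ⟨y, mem_pts.2 hy.1, mem_pts.2 hy.2, fun h => h5 ?_⟩
    rwa [map_add, h, add_zero] at h6
  by_cases hF₂u : F₂ ≤ LinearMap.ker u
  · have h1 : ∀ L ∈ 𝓛, 3 * (if L ≤ F₂ then 2 else if L ≤ F₃ then 0 else 1) ≤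
        2 * #(pts L ∩ pts F₂) := by
      intro L hL
      split_ifs with h2 h3
      · have h5 : pts L ∩ pts F₂ = pts L := inter_eq_left.2 fun x hx =>
          mem_pts.2 ⟨h2 (mem_pts.1 hx).1, (mem_pts.1 hx).2⟩
        rw [h5]
        have := card_pts L
        rw [h4 L hL] at this
        omega
      · omega
      · obtain ⟨x, -, hx, hux⟩ := htrans L hL h2 h3
        exact absurd (hF₂u (mem_pts.1 hx).1) hux
    have h2 := sum_le_sum h1
    rw [← mul_sum, ← mul_sum] at h2
    have h3 := sum_card_pts_inter_le hdis (pts F₂)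
    have h5 := card_pts F₂
    omega
  · set U : Finset V := {x ∈ pts F₂ | u x ≠ 0} with hU
    have hU8 : #U = 8 := by
      have h1 := W_pts_of_not_le hF₂u
      have h2 := W_eq_card_sub (pts F₂) u
      have h3 := card_pts F₂
      rw [← hU] at h2
      omega
    have h1 : ∀ L ∈ 𝓛, (if L ≤ F₂ then 2 else if L ≤ F₃ then 0 else 1) ≤
        #(pts L ∩ U) + if L ≤ F₂ ⊓ LinearMap.ker u then 2 else 0 := by
      intro L hL
      by_cases hL2 : L ≤ F₂
      · by_cases hLu : L ≤ LinearMap.ker u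
        · simp [hL2, hLu]
        · have h2 := W_pts_of_not_le hLu
          have h3 := W_eq_card_sub (pts L) u
          have h5 := card_pts L
          rw [h4 L hL] at h5
          have h6 : pts L ∩ U = {x ∈ pts L | u x ≠ 0} := by
            ext x
            simp only [hU, mem_inter, mem_filter, mem_pts]
            exact ⟨fun h => ⟨h.1, h.2.2⟩, fun h => ⟨h.1, ⟨hL2 h.1.1, h.1.2⟩, h.2⟩⟩
          simp only [hL2, if_true, h6]
          omega
      · by_cases hL3 : L ≤ F₃
        · simp [hL2, hL3]
        · obtain ⟨x, hx, hx2, hux⟩ := htrans L hL hL2 hL3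
          have : 0 < #(pts L ∩ U) :=
            card_pos.2 ⟨x, mem_inter.2 ⟨hx, mem_filter.2 ⟨hx2, hux⟩⟩⟩
          simp only [hL2, hL3, if_false]
          omega
    have h2 : #{L ∈ 𝓛 | L ≤ F₂ ⊓ LinearMap.ker u} ≤ 1 := by
      refine card_le_one.2 fun L hL L' hL' => ?_
      obtain ⟨hL, hLk⟩ := mem_filter.1 hL
      obtain ⟨hL', hLk'⟩ := mem_filter.1 hL'
      by_contra hne
      have h3 := card_mul_card_le_of_disjoint hLk hLk' (hdis hL hL' hne)
      rw [h4 L hL, h4 L' hL'] at h3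
      have h5 : pts (F₂ ⊓ LinearMap.ker u) ⊆ pts F₂ \ U := by
        intro x hx
        simp only [hU, mem_sdiff, mem_filter, mem_pts, Submodule.mem_inf, LinearMap.mem_ker] at hx ⊢
        exact ⟨⟨hx.1.1, hx.2⟩, fun h => h.2 hx.1.2⟩
      have h6 := card_le_card h5
      have h7 := card_sdiff_add_card_eq_card (filter_subset (fun x => u x ≠ 0) (pts F₂))
      rw [← hU] at h7
      have h8 := card_pts (F₂ ⊓ LinearMap.ker u)
      have h9 := card_pts F₂
      omega
    have h3 := sum_le_sum h1
    rw [sum_add_distrib, ← sum_filter, sum_const, smul_eq_mul] at h3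
    have h5 := sum_card_pts_inter_le hdis U
    omega

/-- Pairwise disjoint lines that are disjoint from a plane, all of them inside an `8`-divisible set
of `45` points: there are at most ten of them. -/
lemma IsEightDivisible.card_lines_le {T : Finset V} (hT : IsEightDivisible T) (h0 : (0 : V) ∉ T)
    (h45 : #T = 45) {E : Submodule (ZMod 2) V} (hE : Nat.card E = 8) (hET : pts E ⊆ T)
    {𝓛 : Finset (Submodule (ZMod 2) V)}
    (hdis : (𝓛 : Set (Submodule (ZMod 2) V)).PairwiseDisjoint id) (h4 : ∀ L ∈ 𝓛, Nat.card L = 4)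
    (hLE : ∀ L ∈ 𝓛, Disjoint L E) (hLT : ∀ L ∈ 𝓛, pts L ⊆ T) : #𝓛 ≤ 10 := by
  classical
  have key : ∀ F₁ F₂ F₃ : Submodule (ZMod 2) V, Nat.card F₁ = 16 → Nat.card F₂ = 16 →
      Nat.card F₃ = 16 → Disjoint F₁ F₂ → Disjoint F₁ F₃ →
      (∀ x ∈ T, x ∈ F₁ ∨ x ∈ F₂ ∨ x ∈ F₃) → E ≤ F₁ → #𝓛 ≤ 10 := by
    intro F₁ F₂ F₃ hF₁ hF₂ hF₃ h12 h13 hcov hEF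
    have hc : ∀ L ∈ 𝓛, ∀ x ∈ L, x ≠ 0 → x ∈ F₁ ∨ x ∈ F₂ ∨ x ∈ F₃ := fun L hL x hx hx0 =>
      hcov x (hLT L hL (mem_pts.2 ⟨hx, hx0⟩))
    have h1 := weighted_card_lines_le hE hF₁ hF₂ h12 h13 hEF hdis h4 hLE hc
    have h2 := weighted_card_lines_le hE hF₁ hF₃ h13 h12 hEF hdis h4 hLE
      (fun L hL x hx hx0 => (hc L hL x hx hx0).imp_right Or.symm)
    have h3 : ∑ L ∈ 𝓛, 2 ≤ ∑ L ∈ 𝓛, ((if L ≤ F₂ then 2 else if L ≤ F₃ then 0 else 1) +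
        (if L ≤ F₃ then 2 else if L ≤ F₂ then 0 else 1)) :=
      sum_le_sum fun L _ => by split_ifs <;> omega
    rw [sum_add_distrib, sum_const, smul_eq_mul] at h3
    omega
  obtain ⟨F₁, hF₁, hF₁T⟩ := hT.exists_solid_of_plane h0 h45 hE hET
  obtain ⟨F₂, F₃, hF₂, hF₃, h12, h13, h23, hcov⟩ := hT.exists_three_solids h0 h45 hF₁ hF₁T
  rcases plane_le_of_three_solids hE h12 h13 h23
    (fun x hx hx0 => hcov x (hET (mem_pts.2 ⟨hx, hx0⟩))) with h | h | h
  · exact key F₁ F₂ F₃ hF₁ hF₂ hF₃ h12 h13 hcov h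
  · exact key F₂ F₁ F₃ hF₂ hF₁ hF₃ h12.symm h23 (fun x hx => by have := hcov x hx; tauto) h
  · exact key F₃ F₁ F₂ hF₃ hF₁ hF₂ h13.symm h23.symm
      (fun x hx => by have := hcov x hx; tauto) h

end Counting

/-! ### Four disjoint planes -/

section FourPlanes

variable {V : Type*} [AddCommGroup V] [Module (ZMod 2) V] [Fintype V]

lemma pairwiseDisjoint_pts {𝓠 : Finset (Submodule (ZMod 2) V)}
    (hdis : (𝓠 : Set (Submodule (ZMod 2) V)).PairwiseDisjoint id) :
    (𝓠 : Set (Submodule (ZMod 2) V)).PairwiseDisjoint pts :=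
  fun _ hA _ hB hne => disjoint_pts (hdis hA hB hne)

variable [DecidableEq V]

lemma W_biUnion_pts {𝓠 : Finset (Submodule (ZMod 2) V)}
    (hdis : (𝓠 : Set (Submodule (ZMod 2) V)).PairwiseDisjoint id) (u : Module.Dual (ZMod 2) V) :
    W (𝓠.biUnion pts) u = ∑ B ∈ 𝓠, W (pts B) u :=
  sum_biUnion (pairwiseDisjoint_pts hdis)

/-- An `8`-divisible set of `45` points does not contain four disjoint planes. Otherwise, let `B` be
the union of the planes and consider the signed set with weight `1` on `B` and `-1` on the
remaining points of `T`. Its character sums `2 * W B - W T` are congruent to `11` modulo `16`, so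
they are never strictly between `-5` and `11`; their mean is `0` and their mean square is `45`,
which is less than `5 * 11`. -/
lemma IsEightDivisible.false_of_four_planes {T : Finset V} (hT : IsEightDivisible T)
    (h0 : (0 : V) ∉ T) (h45 : #T = 45) {𝓔 : Finset (Submodule (ZMod 2) V)} (h4 : #𝓔 = 4)
    (hdis : (𝓔 : Set (Submodule (ZMod 2) V)).PairwiseDisjoint id) (h8 : ∀ E ∈ 𝓔, Nat.card E = 8)
    (hET : ∀ E ∈ 𝓔, pts E ⊆ T) : False := by
  set B := 𝓔.biUnion pts with hB
  have hBT : B ⊆ T := biUnion_subset.2 hET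
  have h0B : (0 : V) ∉ B := fun h => h0 (hBT h)
  have hmod : ∀ u, (8 : ℤ) ∣ W B u + 4 := by
    intro u
    have h1 : W B u + 4 = ∑ E ∈ 𝓔, (W (pts E) u + 1) := by
      rw [hB, W_biUnion_pts hdis, sum_add_distrib, sum_const, h4]; rfl
    rw [h1]
    refine dvd_sum fun E hE => ?_
    rcases W_pts_eq_or E u with h | h <;> rw [h] <;> simp [h8 E hE]
  have hN := card_dual_pos (V := V)
  have hnn : 0 ≤ ∑ u : Module.Dual (ZMod 2) V,
      (2 * W B u - W T u - 11) * (2 * W B u - W T u - 11 + 16) := by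
    refine sum_nonneg fun u _ => mul_add_nonneg_of_dvd ?_
    have := hT u
    have := hmod u
    omega
  have h1 : ∀ u : Module.Dual (ZMod 2) V,
      (2 * W B u - W T u - 11) * (2 * W B u - W T u - 11 + 16) =
      4 * (W B u * W B u) - 4 * (W B u * W T u) + W T u * W T u - 12 * W B u + 6 * W T u - 55 :=
    fun u => by ring
  simp only [h1, sum_add_distrib, sum_sub_distrib, ← mul_sum, sum_W_mul_W, sum_W T h0, sum_W B h0B,
    inter_self, inter_eq_left.2 hBT, h45, sum_const, card_univ, nsmul_eq_mul] at hnn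
  push_cast at hnn
  linarith

end FourPlanes

/-! ### Points of the small members of a partition -/

section Partitions

variable {V : Type*} [AddCommGroup V] [Module (ZMod 2) V] [Fintype V] [DecidableEq V]

open Classical in
/-- The points of the members with fewer than `16` vectors of a vector space partition form an
`8`-divisible set. -/
lemma isEightDivisible_biUnion_pts {𝓟 : Finset (Submodule (ZMod 2) V)}
    (hdis : (𝓟 : Set (Submodule (ZMod 2) V)).PairwiseDisjoint id)
    (hcov : ∀ x : V, x ≠ 0 → ∃ B ∈ 𝓟, x ∈ B) (hV : 16 ∣ Nat.card V) :
    IsEightDivisible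
      ((𝓟.filter fun B : Submodule (ZMod 2) V => ¬ 16 ∣ Nat.card B).biUnion pts) := by
  set 𝓠 : Finset (Submodule (ZMod 2) V) := {B ∈ 𝓟 | ¬ 16 ∣ Nat.card B} with h𝓠
  set 𝓑 : Finset (Submodule (ZMod 2) V) := {B ∈ 𝓟 | 16 ∣ Nat.card B} with h𝓑
  have hdis𝓠 : (𝓠 : Set (Submodule (ZMod 2) V)).PairwiseDisjoint id :=
    hdis.subset (by exact_mod_cast filter_subset _ _)
  have hmod : ∀ u, (16 : ℤ) ∣ W (𝓠.biUnion pts) u + 1 - #𝓑 := by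
    intro u
    have h1 : 𝓟.biUnion pts = pts ⊤ := by
      ext x
      simp only [mem_biUnion, mem_pts, Submodule.mem_top, true_and]
      exact ⟨fun ⟨B, _, _, hx⟩ => hx, fun hx => (hcov x hx).imp fun B hB => ⟨hB.1, hB.2, hx⟩⟩
    have h2 := W_biUnion_pts hdis u
    rw [h1, ← sum_filter_add_sum_filter_not 𝓟 (fun B : Submodule (ZMod 2) V => 16 ∣ Nat.card B), ← h𝓑, ← h𝓠,
      ← W_biUnion_pts hdis𝓠] at h2
    have h3 : (16 : ℤ) ∣ W (pts (⊤ : Submodule (ZMod 2) V)) u + 1 := by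
      rcases W_pts_eq_or (⊤ : Submodule (ZMod 2) V) u with h | h <;> rw [h]
      · rw [Nat.card_congr (Submodule.topEquiv (R := ZMod 2) (M := V)).toEquiv]
        exact_mod_cast hV
      · exact dvd_zero _
    have h4 : (16 : ℤ) ∣ ∑ B ∈ 𝓑, (W (pts B) u + 1) := by
      refine dvd_sum fun B hB => ?_
      rcases W_pts_eq_or B u with h | h <;> rw [h]
      · exact_mod_cast (mem_filter.1 hB).2
      · exact dvd_zero _
    rw [sum_add_distrib, sum_const, nsmul_eq_mul, mul_one] at h4
    omega
  intro u
  have h1 := hmod u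
  have h2 := hmod 0
  rw [W_zero] at h2
  omega

end Partitions

/-! ### Supertails -/

section Supertail

variable {V : Type*} [AddCommGroup V] [Module (ZMod 2) V]

lemma disjoint_of_isVectorSpacePartition {P : Set (Submodule (ZMod 2) V)}
    (hP : IsVectorSpacePartition (ZMod 2) P) {A B : Submodule (ZMod 2) V} (hA : A ∈ P) (hB : B ∈ P)
    (hne : A ≠ B) : Disjoint A B := by
  rw [Submodule.disjoint_def]
  intro x hxA hxB
  by_contra hx
  refine hne ((hP.2 (Projectivization.mk (ZMod 2) x hx)).unique ⟨hA, ?_⟩ ⟨hB, ?_⟩) <;>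
    simpa [Projectivization.submodule_mk, Submodule.span_singleton_le_iff_mem]

lemma exists_mem_of_isVectorSpacePartition {P : Set (Submodule (ZMod 2) V)}
    (hP : IsVectorSpacePartition (ZMod 2) P) {x : V} (hx : x ≠ 0) : ∃ B ∈ P, x ∈ B := by
  obtain ⟨B, ⟨hB, hxB⟩, -⟩ := hP.2 (Projectivization.mk (ZMod 2) x hx)
  refine ⟨B, hB, ?_⟩
  simpa [Projectivization.submodule_mk, Submodule.span_singleton_le_iff_mem] using hxB

variable [Finite V]

lemma natCard_eq_two_pow (B : Submodule (ZMod 2) V) :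
    Nat.card B = 2 ^ Module.finrank (ZMod 2) B := by
  have := Module.natCard_eq_pow_finrank (K := ZMod 2) (V := B)
  simpa using this

/-- A supertail of type `3 ^ m₃ 2 ^ m₂ 1 ^ m₁` with `7 * m₃ + 3 * m₂ + m₁ = 45` has neither four planes,
nor a plane and eleven lines: its points form an `8`-divisible set of cardinality `45`. -/
lemma supertail_bounds {P : Set (Submodule (ZMod 2) V)}
    (hP : IsVectorSpacePartition (ZMod 2) P) {m₃ m₂ m₁ : ℕ} (hm : 7 * m₃ + 3 * m₂ + m₁ = 45)
    (hS : HasSupertail (ZMod 2) P ![3, 2, 1] ![m₃, m₂, m₁]) :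
    m₃ ≠ 4 ∧ (m₃ ≠ 0 → m₂ ≤ 10) := by
  classical
  have := Fintype.ofFinite V
  obtain ⟨-, -, hcount, ⟨A, hAP, hA⟩, hsmall⟩ := hS
  have hPfin : P.Finite := Set.toFinite P
  set 𝓟 : Finset (Submodule (ZMod 2) V) := hPfin.toFinset with h𝓟
  have hmem : ∀ B, B ∈ 𝓟 ↔ B ∈ P := by simp [h𝓟]
  have hdis : (𝓟 : Set (Submodule (ZMod 2) V)).PairwiseDisjoint id := by
    intro B hB C hC hne
    exact disjoint_of_isVectorSpacePartition hP ((hmem B).1 hB) ((hmem C).1 hC) hne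
  have hcov : ∀ x : V, x ≠ 0 → ∃ B ∈ 𝓟, x ∈ B := by
    intro x hx
    obtain ⟨B, hB, hxB⟩ := exists_mem_of_isVectorSpacePartition hP hx
    exact ⟨B, (hmem B).2 hB, hxB⟩
  have hbig : ∀ B : Submodule (ZMod 2) V,
      16 ∣ Nat.card B ↔ 4 ≤ Module.finrank (ZMod 2) B := by
    intro B
    rw [natCard_eq_two_pow, show 16 = 2 ^ 4 by norm_num, Nat.pow_dvd_pow_iff_le_right (by norm_num)]
  have hV : 16 ∣ Nat.card V := by
    have h1 := Module.natCard_eq_pow_finrank (K := ZMod 2) (V := V)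
    rw [Nat.card_zmod] at h1
    rw [h1, show 16 = 2 ^ 4 by norm_num, Nat.pow_dvd_pow_iff_le_right (by norm_num)]
    have h2 : 3 < Module.finrank (ZMod 2) A := hA
    have := Submodule.finrank_le A
    omega
  have hT := isEightDivisible_biUnion_pts hdis hcov hV
  set 𝓠 : Finset (Submodule (ZMod 2) V) := {B ∈ 𝓟 | ¬ 16 ∣ Nat.card B} with h𝓠
  set T := 𝓠.biUnion pts with hTdef
  let M : ℕ → Finset (Submodule (ZMod 2) V) := fun d => {B ∈ 𝓟 | Module.finrank (ZMod 2) B = d}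
  have hM : ∀ d B, B ∈ M d ↔ B ∈ P ∧ Module.finrank (ZMod 2) B = d := by simp [M, hmem]
  have hMcard : ∀ j : Fin 3, #(M (![3, 2, 1] j)) = ![m₃, m₂, m₁] j := by
    intro j
    have h1 := hcount j
    have h2 : {B : Submodule (ZMod 2) V | B ∈ P ∧ Module.finrank (ZMod 2) B = ![3, 2, 1] j} =
        (M (![3, 2, 1] j) : Set (Submodule (ZMod 2) V)) := by
      ext B; simp only [Set.mem_ofPred_eq, SetLike.mem_coe, hM]
    rw [h2, Set.encard_coe_eq_coe_finsetCard] at h1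
    exact_mod_cast h1
  have hM3 : #(M 3) = m₃ := hMcard 0
  have hM2 : #(M 2) = m₂ := hMcard 1
  have hM1 : #(M 1) = m₁ := hMcard 2
  have hMP : ∀ d, M d ⊆ 𝓟 := fun d => filter_subset _ _
  have hMQ : ∀ d, d ≤ 3 → M d ⊆ 𝓠 := by
    intro d hd B hB
    refine mem_filter.2 ⟨hMP d hB, ?_⟩
    rw [hbig, ((hM d B).1 hB).2]
    omega
  have hMT : ∀ d, d ≤ 3 → ∀ B ∈ M d, pts B ⊆ T := fun d hd B hB =>
    subset_biUnion_of_mem pts (hMQ d hd hB)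
  have hMdis : ∀ d, (M d : Set (Submodule (ZMod 2) V)).PairwiseDisjoint id := fun d =>
    hdis.subset (by exact_mod_cast hMP d)
  have hne : ∀ {d d' : ℕ}, d ≠ d' → Disjoint (M d) (M d') := by
    intro d d' hdd
    rw [disjoint_left]
    exact fun B hB hB' => hdd (((hM d B).1 hB).2.symm.trans ((hM d' B).1 hB').2)
  have hQ : 𝓠 = M 3 ∪ (M 2 ∪ M 1) := by
    refine Subset.antisymm (fun B hB => ?_)
      (union_subset (hMQ 3 le_rfl) (union_subset (hMQ 2 (by norm_num)) (hMQ 1 (by norm_num))))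
    obtain ⟨hBP, hB⟩ := mem_filter.1 hB
    rw [hbig] at hB
    rw [hmem] at hBP
    obtain ⟨j, hj⟩ := hsmall B hBP (show Module.finrank (ZMod 2) B ≤ 3 by omega)
    simp only [mem_union, hM, hBP, true_and]
    fin_cases j
    · exact .inl hj
    · exact .inr (.inl hj)
    · exact .inr (.inr hj)
  have h0 : (0 : V) ∉ T := by simp [hTdef]
  have h45 : #T = 45 := by
    have hc : ∀ d, ∑ B ∈ M d, #(pts B) = #(M d) * (2 ^ d - 1) := by
      intro d
      refine sum_const_nat fun B hB => ?_
      have h1 := card_pts B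
      rw [natCard_eq_two_pow, ((hM d B).1 hB).2] at h1
      omega
    rw [hTdef, card_biUnion (pairwiseDisjoint_pts (hdis.subset (by
      exact_mod_cast filter_subset _ _))), hQ,
      sum_union (disjoint_union_right.2 ⟨hne (by norm_num), hne (by norm_num)⟩),
      sum_union (hne (by norm_num)), hc, hc, hc, hM3, hM2, hM1]
    omega
  have h8 : ∀ E ∈ M 3, Nat.card E = 8 := fun E hE => by
    rw [natCard_eq_two_pow, ((hM 3 E).1 hE).2]; norm_num
  have h4 : ∀ L ∈ M 2, Nat.card L = 4 := fun L hL => by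
    rw [natCard_eq_two_pow, ((hM 2 L).1 hL).2]; norm_num
  refine ⟨fun h => hT.false_of_four_planes h0 h45 (hM3.trans h) (hMdis 3) h8 (hMT 3 le_rfl),
    fun h => ?_⟩
  obtain ⟨E, hE⟩ := card_pos.1 (show 0 < #(M 3) by omega)
  rw [← hM2]
  refine hT.card_lines_le h0 h45 (h8 E hE) (hMT 3 le_rfl E hE) (hMdis 2) h4 (fun L hL => ?_)
    (hMT 2 (by norm_num))
  refine disjoint_of_isVectorSpacePartition hP ((hM 2 L).1 hL).1 ((hM 3 E).1 hE).1 ?_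
  rintro rfl
  have h1 := ((hM 2 L).1 hL).2
  rw [((hM 3 L).1 hE).2] at h1
  omega

end Supertail

end BinarySpace

theorem mainTheorem3 (v : ℕ) (P : Set (Submodule (ZMod 2) (Fin v → ZMod 2)))
    (hP : IsVectorSpacePartition (ZMod 2) P) :
    (∀ i : ℕ, i ≤ 4 → ¬ HasSupertail (ZMod 2) P ![3, 2, 1] ![4, 4 - i, 5 + 3 * i]) ∧
    ¬ HasSupertail (ZMod 2) P ![3, 2, 1] ![1, 11, 5] := by
  refine ⟨fun i hi h => ?_, fun h => ?_⟩
  · exact (BinarySpace.supertail_bounds hP (by omega) h).1 rfl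
  · have := (BinarySpace.supertail_bounds hP (by norm_num) h).2 one_ne_zero
    omega
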